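/- Let $n\ge 1$, let $\omega$ be a symplectic form on $\mathbb{R}^{2n}$ and let $B$ be a real $2n\times 2n$ matrix such that $\omega(B\xi,\eta)=-\omega(\xi,B\eta)$ for all $\xi,\eta\in\mathbb{R}^{2n}$ and the symmetric bilinear form $\omega(B\cdot,\cdot)$ is definite. The oscillator group $Osc_n(\omega,B)$ is the Lie group with underlying manifold $\mathbb{R}\times\mathbb{R}^{2n}\times\mathbb{R}$ and multiplication $$(z,\xi,t)(v,\eta,s)=\left(z+v+\tfrac12\,\omega(\xi,e^{tB}\eta),\ \xi+e^{tB}\eta,\ t+s\right).$$ Its subgroup $H_n(\omega)=\{(z,\xi,0)\}$ is the Heisenberg group, and $\Gamma_\omega\subset H_n(\omega)$ denotes the subgroup generated by $(1,0,0)$ and $(0,e_i,0)$, $i=1,\dots,2n$, where $e_1,\dots,e_{2n}$ is the standard basis of $\mathbb{R}^{2n}$. A lattice is a discrete subgroup with compact quotient. For positive integers $r=(r_1,\dots,r_n)$ let $\omega_r(\xi,\eta)=\sum_{i=1}^n r_i(\xi_{2i-1}\eta_{2i}-\xi_{2i}\eta_{2i-1})$ and $\Gamma_r=\Gamma_{\omega_r}$.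 Theorem. Let $L$ be a lattice in $Osc_n(\omega,B)$. Then there is a unique tuple $r=(r_1,\dots,r_n)$ of positive integers with $r_i\mid r_{i+1}$ for $i=1,\dots,n-1$ for which there exist a real $2n\times 2n$ matrix $\tilde B$ (with $\omega_r(\tilde B\xi,\eta)=-\omega_r(\xi,\tilde B\eta)$ for all $\xi,\eta$ and $\omega_r(\tilde B\cdot,\cdot)$ definite), an isomorphism of Lie groups $\Phi:Osc_n(\omega,B)\to Osc_n(\omega_r,\tilde B)$ and a vector $\xi_0\in\mathbb{R}^{2n}$ such that $\Phi(L)=L(\xi_0)$; that is, $\Phi(L)$ is the subgroup of $Osc_n(\omega_r,\tilde B)$ generated by $\Gamma_r$ and $(0,\xi_0,1)$, it is a lattice, and $\Phi(L)\cap H_n(\omega_r)=\Gamma_r$. -/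

import Mathlib

open Matrix

/-- The vector space `ℝ²ⁿ`, with coordinates grouped in `n` consecutive pairs: the standard basis
vector `e_{2i-1}` has the index `(i, 0)` and `e_{2i}` has the index `(i, 1)`. -/
abbrev OscVec (n : ℕ) : Type := Fin n × Fin 2 → ℝ

/-- Real `2n × 2n` matrices. -/
abbrev OscMat (n : ℕ) : Type := Matrix (Fin n × Fin 2) (Fin n × Fin 2) ℝ

/-- The data of an oscillator group: `ω` is a symplectic form on `ℝ²ⁿ`, `B` is a matrix with
`ω(Bξ, η) = -ω(ξ, Bη)`, and the (symmetric) bilinear form `ω(B·, ·)` is definite. -/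
structure IsOscPair {n : ℕ} (ω : LinearMap.BilinForm ℝ (OscVec n)) (B : OscMat n) : Prop where
  isAlt : ω.IsAlt
  nondegenerate : ω.Nondegenerate
  skew : ∀ ξ η : OscVec n, ω (B *ᵥ ξ) η = -ω ξ (B *ᵥ η)
  definite : (∀ ξ : OscVec n, ξ ≠ 0 → 0 < ω (B *ᵥ ξ) ξ) ∨
    (∀ ξ : OscVec n, ξ ≠ 0 → ω (B *ᵥ ξ) ξ < 0)

/-- The matrix `e^{tB}`. -/
noncomputable def oscExp {n : ℕ} (B : OscMat n) (t : ℝ) : OscMat n :=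
  NormedSpace.exp (t • B)

theorem oscExp_zero {n : ℕ} (B : OscMat n) : oscExp B 0 = 1 := by
  simp [oscExp]

theorem oscExp_add {n : ℕ} (B : OscMat n) (s t : ℝ) :
    oscExp B (s + t) = oscExp B s * oscExp B t := by
  unfold oscExp
  rw [add_smul, Matrix.exp_add_of_commute]
  exact ((Commute.refl B).smul_left s).smul_right t

theorem oscExp_mul_neg {n : ℕ} (B : OscMat n) (t : ℝ) : oscExp B t * oscExp B (-t) = 1 := by
  rw [← oscExp_add, add_neg_cancel, oscExp_zero]

theorem oscExp_neg_mul {n : ℕ} (B : OscMat n) (t : ℝ) : oscExp B (-t) * oscExp B t = 1 := by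
  rw [← oscExp_add, neg_add_cancel, oscExp_zero]

/-- `e^{tB}` preserves `ω`. -/
theorem IsOscPair.oscExp_form {n : ℕ} {ω : LinearMap.BilinForm ℝ (OscVec n)} {B : OscMat n}
    (h : IsOscPair ω B) (t : ℝ) (ξ η : OscVec n) :
    ω (oscExp B t *ᵥ ξ) (oscExp B t *ᵥ η) = ω ξ η := by
  set J : OscMat n := LinearMap.BilinForm.toMatrix' ω with hJ
  have hω : ∀ x y : OscVec n, ω x y = x ⬝ᵥ J *ᵥ y := by
    intro x y
    rw [hJ, ← Matrix.toBilin'_apply', Matrix.toBilin'_toMatrix']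
  have hdet : IsUnit J := by
    rw [Matrix.isUnit_iff_isUnit_det, isUnit_iff_ne_zero]
    exact Matrix.nondegenerate_iff_det_ne_zero.1
      (LinearMap.BilinForm.nondegenerate_toMatrix'_iff.2 h.nondegenerate)
  have hsk : Bᵀ * J = J * -B := by
    have key : ∀ x y : OscVec n, x ⬝ᵥ (Bᵀ * J) *ᵥ y = x ⬝ᵥ (J * -B) *ᵥ y := by
      intro x y
      have := h.skew x y
      rw [hω, hω] at this
      rw [← Matrix.mulVec_mulVec, Matrix.dotProduct_mulVec, Matrix.vecMul_transpose, this,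
        mul_neg, Matrix.neg_mulVec, dotProduct_neg, Matrix.mulVec_mulVec]
    ext i j
    simpa using key (Pi.single i 1) (Pi.single j 1)
  have hconj : (oscExp B t)ᵀ * J = J * oscExp B (-t) := by
    have hc : (t • B)ᵀ = J * (-t • B) * J⁻¹ := by
      have : Bᵀ = J * -B * J⁻¹ := by
        rw [← hsk, Matrix.mul_nonsing_inv_cancel_right _ _ ((Matrix.isUnit_iff_isUnit_det _).1 hdet)]
      rw [Matrix.transpose_smul, this]
      simp
    unfold oscExp
    rw [← Matrix.exp_transpose, hc, Matrix.exp_conj _ _ hdet,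
      Matrix.nonsing_inv_mul_cancel_right _ _ ((Matrix.isUnit_iff_isUnit_det _).1 hdet)]
  rw [hω, hω, ← Matrix.vecMul_transpose, ← Matrix.dotProduct_mulVec, Matrix.mulVec_mulVec,
    Matrix.mulVec_mulVec, hconj, Matrix.mul_assoc, oscExp_neg_mul, Matrix.mul_one]

/-- The underlying set `ℝ × ℝ²ⁿ × ℝ` of the oscillator group `Osc_n(ω, B)`, with elements
`(z, ξ, t)`. -/
@[ext]
structure Osc {n : ℕ} {ω : LinearMap.BilinForm ℝ (OscVec n)} {B : OscMat n}
    (h : IsOscPair ω B) where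
  z : ℝ
  ξ : OscVec n
  t : ℝ

namespace Osc

variable {n : ℕ} {ω : LinearMap.BilinForm ℝ (OscVec n)} {B : OscMat n} {h : IsOscPair ω B}

/-- The multiplication
`(z, ξ, t)(v, η, s) = (z + v + ω(ξ, e^{tB} η) / 2, ξ + e^{tB} η, t + s)`. -/
noncomputable instance instMul : Mul (Osc h) where
  mul g k := ⟨g.z + k.z + (1 / 2) * ω g.ξ (oscExp B g.t *ᵥ k.ξ), g.ξ + oscExp B g.t *ᵥ k.ξ,
    g.t + k.t⟩

noncomputable instance instOne : One (Osc h) where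
  one := ⟨0, 0, 0⟩

noncomputable instance instInv : Inv (Osc h) where
  inv g := ⟨-g.z, -(oscExp B (-g.t) *ᵥ g.ξ), -g.t⟩

theorem mul_def (g k : Osc h) : g * k =
    ⟨g.z + k.z + (1 / 2) * ω g.ξ (oscExp B g.t *ᵥ k.ξ), g.ξ + oscExp B g.t *ᵥ k.ξ,
      g.t + k.t⟩ := rfl

theorem one_def : (1 : Osc h) = ⟨0, 0, 0⟩ := rfl

theorem inv_def (g : Osc h) : g⁻¹ = ⟨-g.z, -(oscExp B (-g.t) *ᵥ g.ξ), -g.t⟩ := rfl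

noncomputable instance instGroup : Group (Osc h) :=
  Group.ofLeftAxioms
    (by
      intro a b c
      ext i
      · simp only [mul_def, oscExp_add, ← Matrix.mulVec_mulVec, Matrix.mulVec_add, map_add,
          LinearMap.add_apply, h.oscExp_form]
        ring
      · simp [mul_def, oscExp_add, ← Matrix.mulVec_mulVec, Matrix.mulVec_add, add_assoc]
      · simp [mul_def, add_assoc])
    (by
      intro a
      ext i <;> simp [mul_def, one_def, oscExp_zero])
    (by
      intro a
      ext i
      · simp [mul_def, inv_def, one_def, h.isAlt.self_eq_zero]
      · simp [mul_def, inv_def, one_def]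
      · simp [mul_def, inv_def, one_def])

/-- The topology of `ℝ × ℝ²ⁿ × ℝ`. -/
instance instTopologicalSpace : TopologicalSpace (Osc h) :=
  TopologicalSpace.induced (fun g : Osc h => ((g.z, g.ξ, g.t) : ℝ × OscVec n × ℝ)) inferInstance

variable (h)

/-- The Heisenberg group `H_n(ω)` as the subgroup of all `(z, ξ, 0)`. -/
noncomputable def heis : Subgroup (Osc h) where
  carrier := {g | g.t = 0}
  mul_mem' := by
    intro a b ha hb
    simp_all [mul_def]
  one_mem' := rfl
  inv_mem' := by
    intro a ha
    simp_all [inv_def]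

/-- The subgroup `Γ_ω` generated by `(1, 0, 0)` and all `(0, e_i, 0)`, where `e_i` runs through the
standard basis of `ℝ²ⁿ`. -/
noncomputable def gammaSubgroup : Subgroup (Osc h) :=
  Subgroup.closure
    ({⟨1, 0, 0⟩} ∪ Set.range fun i : Fin n × Fin 2 => (⟨0, Pi.single i 1, 0⟩ : Osc h))

/-- The subgroup `⟨Γ_ω ∪ {(0, ξ, 1)}⟩`. -/
noncomputable def gammaExt (ξ : OscVec n) : Subgroup (Osc h) :=
  Subgroup.closure ((gammaSubgroup h : Set (Osc h)) ∪ {⟨0, ξ, 1⟩})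

end Osc

/-- A lattice: a discrete subgroup with compact quotient. -/
structure IsCocompactLattice {G : Type*} [Group G] [TopologicalSpace G] (L : Subgroup G) :
    Prop where
  discrete : DiscreteTopology L
  cocompact : CompactSpace (G ⧸ L)

/-- `M = L(ξ)`: the subgroup `M` is generated by `Γ_ω` and `(0, ξ, 1)`, it is a lattice, and
`M ∩ H_n(ω) = Γ_ω`. -/
structure Osc.IsLatticeOf {n : ℕ} {ω : LinearMap.BilinForm ℝ (OscVec n)} {B : OscMat n}
    {h : IsOscPair ω B} (M : Subgroup (Osc h)) (ξ : OscVec n) : Prop where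
  eq_gammaExt : M = Osc.gammaExt h ξ
  isLattice : IsCocompactLattice M
  inf_heis : M ⊓ Osc.heis h = Osc.gammaSubgroup h

/-- The standard form `ω_r(ξ, η) = ∑ i, r_i (ξ_{2i-1} η_{2i} - ξ_{2i} η_{2i-1})`. -/
noncomputable def oscStdForm {n : ℕ} (r : Fin n → ℝ) : LinearMap.BilinForm ℝ (OscVec n) :=
  LinearMap.mk₂ ℝ
    (fun ξ η => ∑ i, r i * (ξ (i, 0) * η (i, 1) - ξ (i, 1) * η (i, 0)))
    (by
      intro a b c
      rw [← Finset.sum_add_distrib]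
      exact Finset.sum_congr rfl fun i _ => by simp only [Pi.add_apply]; ring)
    (by
      intro k a b
      rw [smul_eq_mul, Finset.mul_sum]
      exact Finset.sum_congr rfl fun i _ => by simp only [Pi.smul_apply, smul_eq_mul]; ring)
    (by
      intro a b c
      rw [← Finset.sum_add_distrib]
      exact Finset.sum_congr rfl fun i _ => by simp only [Pi.add_apply]; ring)
    (by
      intro k a b
      rw [smul_eq_mul, Finset.mul_sum]
      exact Finset.sum_congr rfl fun i _ => by simp only [Pi.smul_apply, smul_eq_mul]; ring)

/-! Existence. The point is that `L` meets the Heisenberg group in a large discrete subgroup.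
Commutators of elements of `L` have `t = 0`, and two elements with `t = 0` have the central
commutator `(ω(ξ, η), 0, 0)`. Suppose the `t`-components of `L` were dense. Cocompactness and
commutators show that a vector orthogonal to all `ξ`-components of `L ∩ H` is killed by `B`, hence
is zero. Discreteness then puts the values of `ω` on these components into some `cℤ`, so `ω(w,
e^{tB} v)` cannot move for small `t` in a dense set, against a nonzero derivative `ω(w, Bv)`. So the
`t`-components are `Tℤ` with `T ≠ 0` (`exists_tSubgroup_generator`), and `ω / c` is integral and
nondegenerate on the `ξ`-components. A symplectic basis with elementary divisors
(`exists_symplectic_generators`) yields `r` and a linear change of coordinates. Rescaling, a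
conjugation and a shear then bring the generators into the required form (`exists_isLatticeOf`).

Uniqueness. The Heisenberg group is the commutator subgroup (`commutator_eq_heis`), so two normal
forms of `L` give an abstract isomorphism of `Γ_r` with `Γ_s`. In `Γ_r`, the elements whose
commutators are all `m`-th powers of central elements form a subgroup of index `(∏ m / gcd(m,
r_i))²` (`exists_index_commutatorPowSet`). These indices for all `m` determine a divisor chain
(`eq_of_prod_div_gcd_eq`). -/

open scoped commutatorElement

/-! ### Analysis of `t ↦ e^{tB}`. -/

section exponential

open scoped Matrix.Norms.Operator

theorem continuous_oscExp {n : ℕ} (B : OscMat n) : Continuous (oscExp B) := by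
  unfold oscExp
  exact NormedSpace.exp_continuous.comp (continuous_id.smul continuous_const)

theorem hasDerivAt_form_oscExp {n : ℕ} (ω : LinearMap.BilinForm ℝ (OscVec n)) (B : OscMat n)
    (u v : OscVec n) : HasDerivAt (fun t => ω u (oscExp B t *ᵥ v)) (ω u (B *ᵥ v)) 0 := by
  have h1 : HasDerivAt (oscExp B) B 0 := by
    have := hasDerivAt_exp_smul_const (𝕂 := ℝ) B 0
    rw [zero_smul, NormedSpace.exp_zero, one_mul] at this
    exact this
  let F : OscMat n →ₗ[ℝ] ℝ := (ω u).comp ((Matrix.mulVecBilin ℝ ℝ).flip v)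
  have h2 : HasFDerivAt F F.toContinuousLinearMap (oscExp B 0) :=
    F.toContinuousLinearMap.hasFDerivAt
  exact h2.comp_hasDerivAt 0 h1

end exponential

theorem continuous_oscExp_mulVec {n : ℕ} (B : OscMat n) :
    Continuous fun p : ℝ × OscVec n => oscExp B p.1 *ᵥ p.2 :=
  ((continuous_oscExp B).comp continuous_fst).matrix_mulVec continuous_snd

theorem continuous_bilinForm {n : ℕ} (ω : LinearMap.BilinForm ℝ (OscVec n)) :
    Continuous fun p : OscVec n × OscVec n => ω p.1 p.2 := by
  let F : OscVec n →ₗ[ℝ] OscVec n →L[ℝ] ℝ :=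
    (LinearMap.toContinuousLinearMap : (OscVec n →ₗ[ℝ] ℝ) ≃ₗ[ℝ] _).toLinearMap.comp ω
  have hF : Continuous F := F.continuous_of_finiteDimensional
  exact (hF.comp continuous_fst).clm_apply continuous_snd

namespace IsOscPair

variable {n : ℕ} {ω : LinearMap.BilinForm ℝ (OscVec n)} {B : OscMat n}

theorem eq_zero_of_mulVec_eq_zero (h : IsOscPair ω B) {u : OscVec n} (hu : B *ᵥ u = 0) :
    u = 0 := by
  by_contra h0
  rcases h.definite with hd | hd <;> simpa [hu] using hd u h0

theorem eq_zero_of_form_eq_zero (h : IsOscPair ω B) {u : OscVec n} (hu : ∀ v, ω u v = 0) :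
    u = 0 :=
  h.nondegenerate.1 u hu

end IsOscPair

theorem LinearMap.eq_zero_of_bounded {V : Type*} [AddCommGroup V] [Module ℝ V] (f : V →ₗ[ℝ] ℝ)
    {C : ℝ} (hf : ∀ v, |f v| ≤ C) : f = 0 := by
  ext v
  by_contra h0
  obtain ⟨k, hk⟩ := exists_nat_gt (C / |f v|)
  have h1 := hf ((k : ℝ) • v)
  have h2 : 0 < |f v| := abs_pos.2 h0
  rw [map_smul, smul_eq_mul, abs_mul, Nat.abs_cast] at h1
  rw [div_lt_iff₀ h2] at hk
  linarith

/-! ### Component formulas and the topological group structure. -/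

namespace Osc

variable {n : ℕ} {ω : LinearMap.BilinForm ℝ (OscVec n)} {B : OscMat n} {h : IsOscPair ω B}

@[simp] theorem mul_z (g k : Osc h) :
    (g * k).z = g.z + k.z + (1 / 2) * ω g.ξ (oscExp B g.t *ᵥ k.ξ) := rfl
@[simp] theorem mul_ξ (g k : Osc h) : (g * k).ξ = g.ξ + oscExp B g.t *ᵥ k.ξ := rfl
@[simp] theorem mul_t (g k : Osc h) : (g * k).t = g.t + k.t := rfl
@[simp] theorem one_z : (1 : Osc h).z = 0 := rfl
@[simp] theorem one_ξ : (1 : Osc h).ξ = 0 := rfl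
@[simp] theorem one_t : (1 : Osc h).t = 0 := rfl
@[simp] theorem inv_z (g : Osc h) : g⁻¹.z = -g.z := rfl
@[simp] theorem inv_ξ (g : Osc h) : g⁻¹.ξ = -(oscExp B (-g.t) *ᵥ g.ξ) := rfl
@[simp] theorem inv_t (g : Osc h) : g⁻¹.t = -g.t := rfl

/-- The homomorphism `(z, ξ, t) ↦ t`. -/
def tHom (h : IsOscPair ω B) : Osc h →* Multiplicative ℝ where
  toFun g := Multiplicative.ofAdd g.t
  map_one' := rfl
  map_mul' _ _ := rfl

@[simp] theorem zpow_t (g : Osc h) (k : ℤ) : (g ^ k).t = k * g.t := by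
  have := congrArg Multiplicative.toAdd (map_zpow (tHom h) g k)
  simpa [tHom] using this

theorem commutator_of_t_eq_zero {g k : Osc h} (hg : g.t = 0) (hk : k.t = 0) :
    ⁅g, k⁆ = ⟨ω g.ξ k.ξ, 0, 0⟩ := by
  have hs := h.isAlt.neg_eq g.ξ k.ξ
  rw [commutatorElement_def, mul_inv_eq_iff_eq_mul, mul_inv_eq_iff_eq_mul]
  ext i
  · simp [hg, hk, oscExp_zero, ← hs]
    ring
  · simp [hg, hk, oscExp_zero, add_comm]
  · simp [hg, hk]

theorem commutator_ξ (g k : Osc h) :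
    ⁅g, k⁆.ξ = (g.ξ + oscExp B g.t *ᵥ k.ξ) - (k.ξ + oscExp B k.t *ᵥ g.ξ) := by
  have h1 : ⁅g, k⁆ * (k * g) = g * k := by simp [commutatorElement_def]
  have h2 := congrArg Osc.ξ h1
  have h3 : ⁅g, k⁆.t = 0 := by simp [commutatorElement_def]
  simp only [mul_ξ, h3, oscExp_zero, one_mulVec] at h2
  rw [← h2, add_sub_cancel_right]

theorem commutator_t (g k : Osc h) : ⁅g, k⁆.t = 0 := by
  simp [commutatorElement_def]

theorem continuous_toProd :
    Continuous fun g : Osc h => ((g.z, g.ξ, g.t) : ℝ × OscVec n × ℝ) :=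
  continuous_induced_dom

theorem continuous_z : Continuous fun g : Osc h => g.z := continuous_toProd.fst
theorem continuous_ξ : Continuous fun g : Osc h => g.ξ := continuous_toProd.snd.fst
theorem continuous_t : Continuous fun g : Osc h => g.t := continuous_toProd.snd.snd

theorem continuous_iff {X : Type*} [TopologicalSpace X] {f : X → Osc h} :
    Continuous f ↔ (Continuous fun x => (f x).z) ∧ (Continuous fun x => (f x).ξ) ∧
      Continuous fun x => (f x).t := by
  refine ⟨fun hf => ⟨continuous_z.comp hf, continuous_ξ.comp hf, continuous_t.comp hf⟩, ?_⟩
  rintro ⟨h1, h2, h3⟩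
  exact continuous_induced_rng.2 (h1.prodMk (h2.prodMk h3))

instance instIsTopologicalGroup : IsTopologicalGroup (Osc h) where
  continuous_mul := by
    have h1 : Continuous fun p : Osc h × Osc h => oscExp B p.1.t *ᵥ p.2.ξ :=
      (continuous_oscExp_mulVec B).comp ((continuous_t.comp continuous_fst).prodMk
        (continuous_ξ.comp continuous_snd))
    refine continuous_iff.2 ⟨?_, ?_, ?_⟩
    · exact ((continuous_z.comp continuous_fst).add (continuous_z.comp continuous_snd)).add
        (continuous_const.mul ((continuous_bilinForm ω).comp
          ((continuous_ξ.comp continuous_fst).prodMk h1)))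
    · exact (continuous_ξ.comp continuous_fst).add h1
    · exact (continuous_t.comp continuous_fst).add (continuous_t.comp continuous_snd)
  continuous_inv := by
    refine continuous_iff.2 ⟨continuous_z.neg, ?_, continuous_t.neg⟩
    exact ((continuous_oscExp_mulVec B).comp (continuous_t.neg.prodMk continuous_ξ)).neg

/-! ### Consequences of cocompactness, and the projections of `L`. -/

variable {L : Subgroup (Osc h)}

theorem exists_eq_mul_of_cocompact [CompactSpace (Osc h ⧸ L)] :
    ∃ R : ℝ, ∀ g : Osc h, ∃ l ∈ L, ∃ u : Osc h, g = l * u ∧ ‖u.ξ‖ ≤ R ∧ |u.t| ≤ R := by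
  -- The bounds are put on inverses because the quotient consists of cosets `gL`, while the factor
  -- from `L` is wanted on the left.
  let U : ℕ → Set (Osc h) := fun k => {g | ‖g⁻¹.ξ‖ < k ∧ |g⁻¹.t| < k}
  have hU : ∀ k, IsOpen (U k) := fun k =>
    (isOpen_lt (continuous_ξ.comp continuous_inv).norm continuous_const).inter
      (isOpen_lt (continuous_t.comp continuous_inv).abs continuous_const)
  have hmono : Monotone U := fun a b hab g hg =>
    ⟨hg.1.trans_le (by exact_mod_cast hab), hg.2.trans_le (by exact_mod_cast hab)⟩
  obtain ⟨k, hk⟩ := (isCompact_univ (X := Osc h ⧸ L)).elim_directed_cover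
    (fun k => ((↑) : Osc h → Osc h ⧸ L) '' U k)
    (fun k => QuotientGroup.isOpenMap_coe _ (hU k))
    (by
      intro q _
      obtain ⟨g, rfl⟩ := QuotientGroup.mk_surjective q
      obtain ⟨k, hk⟩ := exists_nat_gt (max ‖g⁻¹.ξ‖ |g⁻¹.t|)
      exact Set.mem_iUnion.2 ⟨k, g, ⟨(le_max_left _ _).trans_lt hk, (le_max_right _ _).trans_lt hk⟩,
        rfl⟩)
    (Monotone.directed_le fun a b hab => Set.image_mono (hmono hab))
  refine ⟨k, fun g => ?_⟩
  obtain ⟨u, hu, hug⟩ := hk (Set.mem_univ ((g⁻¹ : Osc h) : Osc h ⧸ L))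
  have h1 : u⁻¹ * g⁻¹ ∈ L := QuotientGroup.eq.1 hug
  refine ⟨g * u, by simpa using L.inv_mem h1, u⁻¹, by simp, hu.1.le, hu.2.le⟩

/-- Factoring `(0, v, 0) = l * u` with `u` bounded forces `l.t = -u.t`, so the error `e^{l.t B} u.ξ`
ranges over the image of a compact set. -/
theorem exists_close_ξ [CompactSpace (Osc h ⧸ L)] :
    ∃ C R : ℝ, ∀ v : OscVec n, ∃ l ∈ L, ‖v - l.ξ‖ ≤ C ∧ |l.t| ≤ R := by
  obtain ⟨R, hR⟩ := exists_eq_mul_of_cocompact (L := L)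
  obtain ⟨C, hC⟩ := ((isCompact_Icc (a := -R) (b := R)).prod
    (isCompact_closedBall (0 : OscVec n) R)).exists_bound_of_continuousOn
      (continuous_oscExp_mulVec B).continuousOn
  refine ⟨C, R, fun v => ?_⟩
  obtain ⟨l, hl, u, hu, hξ, ht⟩ := hR ⟨0, v, 0⟩
  have h1 : v = l.ξ + oscExp B l.t *ᵥ u.ξ := congrArg Osc.ξ hu
  have h2 : 0 = l.t + u.t := congrArg Osc.t hu
  have h3 : |l.t| ≤ R := by rwa [eq_neg_of_add_eq_zero_left h2.symm, abs_neg]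
  refine ⟨l, hl, ?_, h3⟩
  rw [h1, add_sub_cancel_left]
  exact hC (l.t, u.ξ) ⟨abs_le.1 h3, by simpa using hξ⟩

theorem exists_close_t [CompactSpace (Osc h ⧸ L)] :
    ∃ R : ℝ, ∀ s : ℝ, ∃ l ∈ L, |s - l.t| ≤ R := by
  obtain ⟨R, hR⟩ := exists_eq_mul_of_cocompact (L := L)
  refine ⟨R, fun s => ?_⟩
  obtain ⟨l, hl, u, hu, -, ht⟩ := hR ⟨0, 0, s⟩
  have h2 : s = l.t + u.t := congrArg Osc.t hu
  exact ⟨l, hl, by rwa [h2, add_sub_cancel_left]⟩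

/-- The additive subgroup of all `t` that occur in elements of `L`. -/
noncomputable def tSubgroup (L : Subgroup (Osc h)) : AddSubgroup ℝ := (L.map (tHom h)).toAddSubgroup'

theorem mem_tSubgroup {t : ℝ} : t ∈ tSubgroup L ↔ ∃ l ∈ L, l.t = t := Iff.rfl

/-- The additive subgroup of all `z` with `(z, 0, 0) ∈ L`. -/
def zSubgroup (L : Subgroup (Osc h)) : AddSubgroup ℝ where
  carrier := {z | (⟨z, 0, 0⟩ : Osc h) ∈ L}
  add_mem' := by
    intro a b ha hb
    have := L.mul_mem ha hb
    simpa [mul_def] using this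
  zero_mem' := L.one_mem
  neg_mem' := by
    intro a ha
    have := L.inv_mem ha
    simpa [inv_def] using this

theorem mem_zSubgroup {z : ℝ} : z ∈ zSubgroup L ↔ (⟨z, 0, 0⟩ : Osc h) ∈ L := Iff.rfl

/-- The vectors `ξ` with `(z, ξ, 0) ∈ L` for some `z`. -/
def ξSubgroup (L : Subgroup (Osc h)) : AddSubgroup (OscVec n) where
  carrier := {v | ∃ z, (⟨z, v, 0⟩ : Osc h) ∈ L}
  add_mem' := by
    rintro a b ⟨y, ha⟩ ⟨z, hb⟩
    have := L.mul_mem ha hb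
    exact ⟨_, by simpa [mul_def, oscExp_zero] using this⟩
  zero_mem' := ⟨0, L.one_mem⟩
  neg_mem' := by
    rintro a ⟨z, ha⟩
    have := L.inv_mem ha
    exact ⟨_, by simpa [inv_def, oscExp_zero] using this⟩

theorem mem_ξSubgroup {v : OscVec n} : v ∈ ξSubgroup L ↔ ∃ l ∈ L, l.t = 0 ∧ l.ξ = v := by
  constructor
  · rintro ⟨z, hz⟩
    exact ⟨_, hz, rfl, rfl⟩
  · rintro ⟨⟨z, ξ, t⟩, hl, rfl, rfl⟩
    exact ⟨z, hl⟩

/-- The commutator of lifts of `v` and `w` is the central element `(ω(v, w), 0, 0)`. -/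
theorem form_mem_zSubgroup {v w : OscVec n} (hv : v ∈ ξSubgroup L) (hw : w ∈ ξSubgroup L) :
    ω v w ∈ zSubgroup L := by
  obtain ⟨y, hy⟩ := hv
  obtain ⟨z, hz⟩ := hw
  have : ⁅(⟨y, v, 0⟩ : Osc h), ⟨z, w, 0⟩⁆ ∈ L := by
    rw [commutatorElement_def]
    exact L.mul_mem (L.mul_mem (L.mul_mem hy hz) (L.inv_mem hy)) (L.inv_mem hz)
  rwa [commutator_of_t_eq_zero rfl rfl] at this

/-- Conjugation by `l` acts on the `ξ`-components of the Heisenberg group as `e^{l.t B}`. -/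
theorem oscExp_mulVec_mem_ξSubgroup {l : Osc h} (hl : l ∈ L) {v : OscVec n}
    (hv : v ∈ ξSubgroup L) : oscExp B l.t *ᵥ v ∈ ξSubgroup L := by
  obtain ⟨y, hy⟩ := hv
  refine mem_ξSubgroup.2 ⟨_, L.mul_mem (L.mul_mem hl hy) (L.inv_mem hl), by simp, ?_⟩
  simp [mulVec_neg, oscExp_mul_neg]

/-! ### Discreteness of the central part and of the `t`-projection. -/

/-- Discreteness of `L` isolates `0`, so the group is cyclic. Its generator is not `0`: otherwise
`ω` would vanish on `ξSubgroup L`, and `hs` would first make that subgroup trivial and then every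
vector zero. -/
theorem exists_zSubgroup_eq (hn : 1 ≤ n) [DiscreteTopology L]
    (hs : ∀ u, (∀ v ∈ ξSubgroup L, ω u v = 0) → u = 0) :
    ∃ c : ℝ, 0 < c ∧ ∀ z, z ∈ zSubgroup L ↔ ∃ k : ℤ, z = k * c := by
  obtain ⟨ε, hε, hd⟩ : ∃ ε > 0, ∀ z, (⟨z, 0, 0⟩ : Osc h) ∈ L → |z| < ε → z = 0 := by
    have h1 : IsOpen ({1} : Set L) := isOpen_discrete _
    obtain ⟨U, hU, hU1⟩ := isOpen_induced_iff.1 h1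
    have h2 : Continuous fun z : ℝ => (⟨z, 0, 0⟩ : Osc h) :=
      continuous_iff.2 ⟨continuous_id, continuous_const, continuous_const⟩
    have h3 : (0 : ℝ) ∈ (fun z : ℝ => (⟨z, 0, 0⟩ : Osc h)) ⁻¹' U := by
      have : (1 : L) ∈ (Subtype.val ⁻¹' U : Set L) := by rw [hU1]; rfl
      exact this
    obtain ⟨ε, hε, hb⟩ := Metric.isOpen_iff.1 (hU.preimage h2) 0 h3
    refine ⟨ε, hε, fun z hz hzε => ?_⟩
    have h4 : (⟨z, 0, 0⟩ : Osc h) ∈ U := hb (by simpa using hzε)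
    have h5 : (⟨⟨z, 0, 0⟩, hz⟩ : L) ∈ (Subtype.val ⁻¹' U : Set L) := h4
    rw [hU1] at h5
    exact congrArg (fun l : L => l.1.z) h5
  obtain ⟨a, ha⟩ := AddSubgroup.cyclic_of_isolated_zero (H := zSubgroup L) hε (by
    rw [Set.disjoint_left]
    rintro z hz ⟨h1, h2⟩
    exact h1.ne' (hd z hz (by rwa [abs_of_pos h1])))
  have ha' : ∀ z, z ∈ zSubgroup L ↔ ∃ k : ℤ, z = k * a := by
    intro z
    rw [ha, AddSubgroup.mem_closure_singleton]
    simp [eq_comm]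
  have ha0 : a ≠ 0 := by
    rintro rfl
    have hz : ∀ v ∈ ξSubgroup L, v = 0 := fun v hv => hs v fun w hw => by
      obtain ⟨k, hk⟩ := (ha' _).1 (form_mem_zSubgroup hv hw)
      simpa using hk
    have := hs (Pi.single (⟨0, hn⟩, 0) 1) fun v hv => by simp [hz v hv]
    simpa using congrFun this (⟨0, hn⟩, 0)
  refine ⟨|a|, abs_pos.2 ha0, fun z => (ha' z).trans ?_⟩
  rcases abs_choice a with h1 | h1 <;> rw [h1]
  constructor <;> rintro ⟨k, rfl⟩ <;> exact ⟨-k, by push_cast; ring⟩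

theorem exists_tSubgroup_generator (hn : 1 ≤ n) (hL : IsCocompactLattice L) :
    ∃ T : ℝ, T ≠ 0 ∧ ∀ t, t ∈ tSubgroup L ↔ ∃ k : ℤ, t = k * T := by
  have := hL.discrete
  have := hL.cocompact
  rcases (tSubgroup L).dense_or_cyclic with hdense | ⟨T, hT⟩
  · exfalso
    obtain ⟨C, R, hCR⟩ := exists_close_ξ (L := L)
    -- Nondegeneracy in the dense case: `ω(u, ·)` turns out to be invariant under all `e^{tB}`, and
    -- differentiating at `t = 0` gives `Bu = 0`.
    have hs : ∀ u, (∀ v ∈ ξSubgroup L, ω u v = 0) → u = 0 := by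
      intro u hu
      have key : ∀ t ∈ tSubgroup L, ∀ v, ω u (oscExp B t *ᵥ v) = ω u v := by
        rintro t ⟨x, hx, rfl⟩ v
        change ω u (oscExp B x.t *ᵥ v) = ω u v
        let F : OscVec n →ₗ[ℝ] ℝ := (ω u).comp ((oscExp B x.t).mulVecLin - LinearMap.id)
        have hF : ∀ v, F v = ω u (oscExp B x.t *ᵥ v) - ω u v := fun v => by simp [F]
        have hc : Continuous fun p : ℝ × OscVec n =>
            F p.2 - (ω u x.ξ - ω u (oscExp B p.1 *ᵥ x.ξ)) := by
          have h1 : Continuous fun p : ℝ × OscVec n => ω u (oscExp B p.1 *ᵥ x.ξ) :=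
            (ω u).continuous_of_finiteDimensional.comp ((continuous_oscExp_mulVec B).comp
              (continuous_fst.prodMk continuous_const))
          exact (F.continuous_of_finiteDimensional.comp continuous_snd).sub
            (continuous_const.sub h1)
        obtain ⟨K, hK⟩ := ((isCompact_Icc (a := -R) (b := R)).prod
          (isCompact_closedBall (0 : OscVec n) C)).exists_bound_of_continuousOn hc.continuousOn
        -- As `u` is orthogonal to the `ξ`-component of `⁅x, l⁆`, the value `F l.ξ` depends only on
        -- the bounded number `l.t`. Every `w` is within `C` of such an `l.ξ`, so the linear map `F`
        -- is bounded on the whole space.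
        have hb : F = 0 := F.eq_zero_of_bounded (C := K) fun w => by
          obtain ⟨l, hl, h1, h2⟩ := hCR w
          have h3 := hu ⁅x, l⁆.ξ (mem_ξSubgroup.2 ⟨⁅x, l⁆, by
            rw [commutatorElement_def]
            exact L.mul_mem (L.mul_mem (L.mul_mem hx hl) (L.inv_mem hx)) (L.inv_mem hl),
            commutator_t _ _, rfl⟩)
          rw [commutator_ξ] at h3
          have h4 := hK (l.t, w - l.ξ) ⟨abs_le.1 h2, by simpa using h1⟩
          have h5 : F w = F (w - l.ξ) - (ω u x.ξ - ω u (oscExp B l.t *ᵥ x.ξ)) := by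
            simp only [map_sub, map_add] at h3 ⊢
            rw [hF l.ξ]
            linarith
          rw [h5]
          exact h4
        have := hF v
        rw [hb, LinearMap.zero_apply] at this
        linarith
      have key' : ∀ v t, ω u (oscExp B t *ᵥ v) = ω u v := by
        intro v t
        have hc : Continuous fun t => ω u (oscExp B t *ᵥ v) :=
          (ω u).continuous_of_finiteDimensional.comp ((continuous_oscExp_mulVec B).comp
            (continuous_id.prodMk continuous_const))
        exact congrFun (hc.ext_on hdense continuous_const fun t ht => key t ht v) t
      refine h.eq_zero_of_mulVec_eq_zero (h.eq_zero_of_form_eq_zero fun v => ?_)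
      have hd := hasDerivAt_form_oscExp ω B u v
      simp only [key'] at hd
      have h6 := h.skew u v
      rw [hd.unique (hasDerivAt_const 0 _), neg_zero] at h6
      exact h6
    obtain ⟨c, hc, hz⟩ := exists_zSubgroup_eq hn hs
    -- For small `t` in the dense set, `ω(w, e^{tB} v) - ω(w, v)` is a multiple of `c` of size less
    -- than `c`, so it vanishes. A nonzero derivative at `0` excludes this for small `t ≠ 0`.
    obtain ⟨w, hw, v, hv, hwv⟩ : ∃ w ∈ ξSubgroup L, ∃ v ∈ ξSubgroup L, ω w (B *ᵥ v) ≠ 0 := by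
      by_contra! hcon
      have h1 : ∀ w ∈ ξSubgroup L, w = 0 := fun w hw =>
        h.eq_zero_of_mulVec_eq_zero (hs _ fun v hv => by rw [h.skew, hcon w hw v hv, neg_zero])
      have := hs (Pi.single (⟨0, hn⟩, 0) 1) fun v hv => by simp [h1 v hv]
      simpa using congrFun this (⟨0, hn⟩, 0)
    have hd := hasDerivAt_form_oscExp ω B w v
    have h1 := hd.eventually_ne (c := ω w v) hwv
    have h2 : ∀ᶠ t in nhds (0 : ℝ), |ω w (oscExp B t *ᵥ v) - ω w v| < c := by
      have := (hd.continuousAt.sub (continuousAt_const (y := ω w v))).abs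
      refine this.eventually_lt_const ?_
      simpa [oscExp_zero] using hc
    obtain ⟨ε, hε, hball⟩ := Metric.eventually_nhds_iff.1
      ((eventually_nhdsWithin_iff.1 h1).and h2)
    obtain ⟨t, ht, htL⟩ := hdense.exists_mem_open isOpen_Ioo (Set.nonempty_Ioo.2 hε)
    obtain ⟨h3, h4⟩ := hball (y := t) (by simpa [abs_of_pos htL.1] using htL.2)
    obtain ⟨x, hx, rfl⟩ := ht
    change ∀ _ : x.t ∈ _, ω w (oscExp B x.t *ᵥ v) ≠ _ at h3
    change |ω w (oscExp B x.t *ᵥ v) - ω w v| < c at h4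
    obtain ⟨k, hk⟩ := (hz _).1 (form_mem_zSubgroup hw
      (AddSubgroup.sub_mem _ (oscExp_mulVec_mem_ξSubgroup hx hv) hv))
    rw [map_sub] at hk
    rw [hk, abs_mul, abs_of_pos hc] at h4
    have h5 : |(k : ℝ)| < 1 := by
      by_contra! h6
      nlinarith
    have h6 : k = 0 := by
      rw [← Int.abs_lt_one_iff]
      exact_mod_cast h5
    rw [h6, Int.cast_zero, zero_mul, sub_eq_zero] at hk
    exact h3 htL.1.ne' hk
  · have hT' : ∀ t, t ∈ tSubgroup L ↔ ∃ k : ℤ, t = k * T := by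
      intro t
      rw [hT, AddSubgroup.mem_closure_singleton]
      simp [eq_comm]
    refine ⟨T, ?_, hT'⟩
    rintro rfl
    obtain ⟨R, hR⟩ := exists_close_t (L := L)
    obtain ⟨l, hl, hlR⟩ := hR (|R| + 1)
    obtain ⟨k, hk⟩ := (hT' l.t).1 ⟨l, hl, rfl⟩
    rw [hk, mul_zero, sub_zero, abs_of_pos (by positivity)] at hlR
    linarith [le_abs_self R]

/-- Each `l ∈ L` is an element of `L ∩ H` times a power of a fixed `x` with `x.t = T`. Bounded `l.t`
allows only finitely many powers, so `ω(u, ·)` is bounded on vectors close to such `l.ξ`, that is,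
on all vectors. -/
theorem eq_zero_of_form_ξSubgroup_eq_zero [CompactSpace (Osc h ⧸ L)] {T : ℝ} (hT0 : T ≠ 0)
    (hT : ∀ t, t ∈ tSubgroup L ↔ ∃ k : ℤ, t = k * T) (u : OscVec n)
    (hu : ∀ v ∈ ξSubgroup L, ω u v = 0) : u = 0 := by
  obtain ⟨C, R, hCR⟩ := exists_close_ξ (L := L)
  obtain ⟨x, hx, hxT⟩ := (mem_tSubgroup (L := L)).1 ((hT T).2 ⟨1, by simp⟩)
  obtain ⟨N, hN⟩ := exists_nat_gt (R / |T|)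
  obtain ⟨K, hK⟩ := (((Set.finite_Icc (-(N : ℤ)) N).image
    fun k => |ω u (x ^ k).ξ|)).bddAbove
  obtain ⟨K', hK'⟩ := (isCompact_closedBall (0 : OscVec n) C).exists_bound_of_continuousOn
    (ω u).continuous_of_finiteDimensional.continuousOn
  refine h.eq_zero_of_form_eq_zero fun v => ?_
  have : ω u = 0 := (ω u).eq_zero_of_bounded (C := K' + K) fun v => by
    obtain ⟨l, hl, h1, h2⟩ := hCR v
    obtain ⟨k, hk⟩ := (hT l.t).1 ⟨l, hl, rfl⟩
    have hd : l * x ^ (-k) ∈ L := L.mul_mem hl (L.zpow_mem hx _)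
    have hdt : (l * x ^ (-k)).t = 0 := by simp [hk, hxT]
    have hl2 : l.ξ = (l * x ^ (-k)).ξ + (x ^ k).ξ := by
      have h3 : l = (l * x ^ (-k)) * x ^ k := by simp
      have h4 := congrArg Osc.ξ h3
      rwa [mul_ξ (l * x ^ (-k)), hdt, oscExp_zero, one_mulVec] at h4
    have h5 := hu _ (mem_ξSubgroup.2 ⟨_, hd, hdt, rfl⟩)
    have h6 : ω u v = ω u (v - l.ξ) + ω u (x ^ k).ξ := by
      conv_rhs => rw [hl2]
      rw [map_sub, map_add, h5]
      ring
    have h7 : |k| ≤ (N : ℤ) := by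
      rw [hk, abs_mul, ← le_div_iff₀ (abs_pos.2 hT0)] at h2
      have : |(k : ℝ)| ≤ N := h2.trans hN.le
      exact_mod_cast this
    have h8 : |ω u (x ^ k).ξ| ≤ K := hK ⟨k, abs_le.1 h7, rfl⟩
    have h9 : |ω u (v - l.ξ)| ≤ K' := hK' _ (by simpa using h1)
    rw [h6]
    exact (abs_add_le _ _).trans (add_le_add h9 h8)
  rw [this, LinearMap.zero_apply]

end Osc

/-! ### Symplectic bases with elementary divisors, and standard coordinates. -/

/-- An alternating form that is integer-valued and nondegenerate on an additive subgroup `M` has a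
symplectic basis of `M` with elementary divisors. -/
theorem LinearMap.BilinForm.IsAlt.exists_symplectic_generators {V : Type*} [AddCommGroup V] [Module ℝ V]
    [FiniteDimensional ℝ V] {ω : LinearMap.BilinForm ℝ V} (hω : ω.IsAlt) (M : AddSubgroup V)
    (hint : ∀ x ∈ M, ∀ y ∈ M, ∃ a : ℤ, ω x y = a)
    (hnd : ∀ x ∈ M, (∀ y ∈ M, ω x y = 0) → x = 0) :
    ∃ (m : ℕ) (r : Fin m → ℕ) (e f : Fin m → V), (∀ i, 0 < r i) ∧
      (∀ (i : ℕ) (hi : i + 1 < m), r ⟨i, Nat.lt_of_succ_lt hi⟩ ∣ r ⟨i + 1, hi⟩) ∧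
      (∀ i, e i ∈ M) ∧ (∀ i, f i ∈ M) ∧
      (∀ i j, ω (e i) (f j) = if i = j then (r i : ℝ) else 0) ∧
      (∀ i j, ω (e i) (e j) = 0) ∧ (∀ i j, ω (f i) (f j) = 0) ∧
      ∀ x ∈ M, ∃ a b : Fin m → ℤ, x = ∑ i, (a i • e i + b i • f i) := by
  classical
  induction hk : Module.finrank ℝ (Submodule.span ℝ (M : Set V)) using Nat.strong_induction_on
    generalizing M with
  | _ k ih =>
  by_cases hM : ∀ x ∈ M, x = 0
  · exact ⟨0, Fin.elim0, Fin.elim0, Fin.elim0, fun i => i.elim0, fun i hi => by omega,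
      fun i => i.elim0, fun i => i.elim0, fun i => i.elim0, fun i => i.elim0, fun i => i.elim0,
      fun x hx => ⟨Fin.elim0, Fin.elim0, by simp [hM x hx]⟩⟩
  have hex : ∃ d : ℕ, 0 < d ∧ ∃ x ∈ M, ∃ y ∈ M, ω x y = d := by
    push Not at hM
    obtain ⟨x, hx, hx0⟩ := hM
    obtain ⟨y, hy, hxy⟩ : ∃ y ∈ M, ω x y ≠ 0 := by
      by_contra! hcon
      exact hx0 (hnd x hx hcon)
    obtain ⟨a, ha⟩ := hint x hx y hy
    have ha0 : a ≠ 0 := by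
      rintro rfl
      simp [ha] at hxy
    rcases Int.natAbs_eq a with h1 | h1
    · exact ⟨a.natAbs, Int.natAbs_pos.2 ha0, x, hx, y, hy, by
        rw [ha, ← Int.cast_natCast (R := ℝ), ← h1]⟩
    · refine ⟨a.natAbs, Int.natAbs_pos.2 ha0, x, hx, -y, M.neg_mem hy, ?_⟩
      rw [map_neg, ha, neg_eq_iff_eq_neg, ← Int.cast_natCast (R := ℝ), ← Int.cast_neg, ← h1]
  set d := Nat.find hex with hd
  obtain ⟨hdpos, x, hx, y, hy, hxy⟩ := Nat.find_spec hex
  rw [← hd] at hdpos hxy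
  have hdR : (d : ℝ) ≠ 0 := by exact_mod_cast hdpos.ne'
  -- a vector taking the minimal value takes only multiples of it
  have hdvd : ∀ v ∈ M, ∀ w ∈ M, ω v w = d → ∀ z ∈ M, ∃ q : ℤ, ω v z = q * d := by
    intro v hv w hw hvw z hz
    obtain ⟨a, ha⟩ := hint v hv z hz
    refine ⟨a / d, ?_⟩
    have h1 : ω v (z - (a / (d : ℤ)) • w) = ((a % d : ℤ) : ℝ) := by
      rw [map_sub, map_zsmul, ha, hvw, Int.emod_def]
      push_cast
      simp [mul_comm]
    have h2 : 0 ≤ a % (d : ℤ) := Int.emod_nonneg _ (by omega)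
    have h3 : a % (d : ℤ) < d := Int.emod_lt_of_pos _ (by omega)
    by_cases h4 : a % (d : ℤ) = 0
    · rw [ha]
      exact_mod_cast (Int.ediv_mul_cancel (Int.dvd_of_emod_eq_zero h4)).symm
    · exfalso
      refine Nat.find_min hex (m := (a % (d : ℤ)).toNat) (by omega)
        ⟨by omega, v, hv, _, M.sub_mem hz (M.zsmul_mem hw (a / (d : ℤ))), ?_⟩
      rw [h1]
      exact_mod_cast (Int.toNat_of_nonneg h2).symm
  have hx' := hdvd x hx y hy hxy
  have hyx : ω y (-x) = d := by rw [map_neg, hω.neg_eq, hxy]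
  have hy' := hdvd y hy (-x) (M.neg_mem hx) hyx
  have hxx : ω x x = 0 := hω x
  have hyy : ω y y = 0 := hω y
  have hyx' : ω y x = -d := by rw [← hxy, hω.neg_eq]
  let M' : AddSubgroup V :=
    { carrier := {z | z ∈ M ∧ ω x z = 0 ∧ ω y z = 0}
      add_mem' := fun {a b} ha hb => ⟨M.add_mem ha.1 hb.1, by simp [ha.2.1, hb.2.1],
        by simp [ha.2.2, hb.2.2]⟩
      zero_mem' := ⟨M.zero_mem, by simp, by simp⟩
      neg_mem' := fun {a} ha => ⟨M.neg_mem ha.1, by simp [ha.2.1], by simp [ha.2.2]⟩ }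
  have hM'M : ∀ z ∈ M', z ∈ M := fun z hz => hz.1
  -- Projecting off the plane of `x, y` needs only integer coefficients, because `d` divides `ω(x,
  -- z)` and `ω(y, z)`.
  have hdecomp : ∀ z ∈ M, ∃ a b : ℤ, ∃ z' ∈ M', z = a • x + b • y + z' := by
    intro z hz
    obtain ⟨b, hb⟩ := hx' z hz
    obtain ⟨a, ha⟩ := hy' z hz
    refine ⟨-a, b, z - (-a • x + b • y), ⟨M.sub_mem hz (M.add_mem (M.zsmul_mem hx _)
      (M.zsmul_mem hy _)), ?_, ?_⟩, by abel⟩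
    · simp [hb, hxx, hxy]
    · simp [ha, hyy, hyx']
  -- The rank drops since `ω(y, ·)` vanishes on `M'` but not at `x`.
  have hlt : Module.finrank ℝ (Submodule.span ℝ (M' : Set V)) < k := by
    rw [← hk]
    refine Submodule.finrank_lt_finrank_of_lt (lt_of_le_of_ne
      (Submodule.span_mono hM'M) fun heq => ?_)
    have h1 : x ∈ Submodule.span ℝ (M' : Set V) := heq ▸ Submodule.subset_span hx
    have h2 : Submodule.span ℝ (M' : Set V) ≤ LinearMap.ker (ω y) :=
      Submodule.span_le.2 fun z hz => hz.2.2
    have h3 : ω y x = 0 := h2 h1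
    rw [hyx'] at h3
    exact hdR (neg_eq_zero.1 h3)
  obtain ⟨m, r, e, f, hr, hrdvd, he, hf, hef, hee, hff, hcoord⟩ := ih _ hlt M'
    (fun v hv w hw => hint v hv.1 w hw.1)
    (fun v hv hv0 => hnd v hv.1 fun w hw => by
      obtain ⟨a, b, w', hw', rfl⟩ := hdecomp w hw
      have h1 : ω v x = 0 := by rw [← hω.neg_eq, hv.2.1, neg_zero]
      have h2 : ω v y = 0 := by rw [← hω.neg_eq, hv.2.2, neg_zero]
      simp [h1, h2, hv0 w' hw']) rfl
  have hdr : ∀ i, d ∣ r i := by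
    intro i
    -- The vector `x + e i` also attains the minimal value `d`, so `d` divides its pairing with `f
    -- i`, which is `r i`.
    have h1 : ω (x + e i) y = d := by
      rw [map_add, LinearMap.add_apply, hxy, ← hω.neg_eq y (e i), (he i).2.2, neg_zero, add_zero]
    obtain ⟨q, hq⟩ := hdvd _ (M.add_mem hx (he i).1) y hy h1 (f i) (hf i).1
    rw [map_add, LinearMap.add_apply, (hf i).2.1, hef, if_pos rfl, zero_add] at hq
    have h2 : (r i : ℤ) = q * d := by exact_mod_cast hq
    exact Int.natCast_dvd_natCast.1 ⟨q, by rw [h2, mul_comm]⟩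
  have hsymm : ∀ v w, ω v w = 0 → ω w v = 0 := fun v w hvw => by rw [← hω.neg_eq, hvw, neg_zero]
  refine ⟨m + 1, Fin.cons d r, Fin.cons x e, Fin.cons y f, ?_, ?_, ?_, ?_, ?_, ?_, ?_, ?_⟩
  · exact Fin.cases hdpos hr
  · intro i hi
    rcases i with _ | i
    · exact hdr ⟨0, by omega⟩
    · exact hrdvd i (by omega)
  · exact Fin.cases hx fun i => (he i).1
  · exact Fin.cases hy fun i => (hf i).1
  · refine Fin.cases (Fin.cases (by simpa using hxy) fun j => ?_)
      (fun i => Fin.cases ?_ fun j => ?_)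
    · simpa [(Fin.succ_ne_zero j).symm] using (hf j).2.1
    · simpa using hsymm _ _ (he i).2.2
    · simpa using hef i j
  · refine Fin.cases (Fin.cases (by simpa using hxx) fun j => ?_)
      (fun i => Fin.cases ?_ fun j => ?_)
    · simpa using (he j).2.1
    · simpa using hsymm _ _ (he i).2.1
    · simpa using hee i j
  · refine Fin.cases (Fin.cases (by simpa using hyy) fun j => ?_)
      (fun i => Fin.cases ?_ fun j => ?_)
    · simpa using (hf j).2.2
    · simpa using hsymm _ _ (hf i).2.2
    · simpa using hff i j
  · intro z hz
    obtain ⟨a, b, z', hz', rfl⟩ := hdecomp z hz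
    obtain ⟨a', b', rfl⟩ := hcoord z' hz'
    refine ⟨Fin.cons a a', Fin.cons b b', ?_⟩
    simp [Fin.sum_univ_succ]

theorem oscStdForm_apply {n : ℕ} (r : Fin n → ℝ) (ξ η : OscVec n) :
    oscStdForm r ξ η = ∑ i, r i * (ξ (i, 0) * η (i, 1) - ξ (i, 1) * η (i, 0)) := rfl

theorem oscStdForm_single_zero {n : ℕ} (r : Fin n → ℝ) (ξ : OscVec n) (i : Fin n) :
    oscStdForm r ξ (Pi.single (i, 0) 1) = - (r i * ξ (i, 1)) := by
  rw [oscStdForm_apply, Finset.sum_eq_single i] <;> simp +contextual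

theorem oscStdForm_single_one {n : ℕ} (r : Fin n → ℝ) (ξ : OscVec n) (i : Fin n) :
    oscStdForm r ξ (Pi.single (i, 1) 1) = r i * ξ (i, 0) := by
  rw [oscStdForm_apply, Finset.sum_eq_single i] <;> simp +contextual

theorem exists_standard_coordinates {n : ℕ} {ω : LinearMap.BilinForm ℝ (OscVec n)} (hω : ω.IsAlt)
    (M : AddSubgroup (OscVec n)) {c : ℝ} (hc : 0 < c)
    (hint : ∀ x ∈ M, ∀ y ∈ M, ∃ a : ℤ, ω x y = a * c)
    (hnd : ∀ u, (∀ y ∈ M, ω u y = 0) → u = 0) :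
    ∃ (r : Fin n → ℕ) (A : OscVec n ≃ₗ[ℝ] OscVec n), (∀ i, 0 < r i) ∧
      (∀ (i : ℕ) (hi : i + 1 < n), r ⟨i, Nat.lt_of_succ_lt hi⟩ ∣ r ⟨i + 1, hi⟩) ∧
      (∀ x y, oscStdForm (fun i => (r i : ℝ)) (A x) (A y) = ω x y / c) ∧
      (∀ i, A.symm (Pi.single i 1) ∈ M) ∧ ∀ x ∈ M, ∀ i, ∃ a : ℤ, A x i = a := by
  have hc' := hc.ne'
  obtain ⟨ω', hω'⟩ : ∃ ω' : LinearMap.BilinForm ℝ (OscVec n), ∀ x y, ω' x y = ω x y / c :=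
    ⟨c⁻¹ • ω, fun x y => by simp [div_eq_inv_mul]⟩
  have halt : ω'.IsAlt := fun x => by rw [hω', hω.self_eq_zero, zero_div]
  have hnd' : ∀ u, (∀ y ∈ M, ω' u y = 0) → u = 0 := fun u h0 => hnd u fun y hy => by
    simpa [hω', hc'] using h0 y hy
  obtain ⟨m, r, e, f, hr, hrdvd, he, hf, hef, hee, hff, hcoord⟩ :=
    LinearMap.BilinForm.IsAlt.exists_symplectic_generators halt M
      (fun x hx y hy => by
        obtain ⟨a, ha⟩ := hint x hx y hy
        exact ⟨a, by rw [hω', ha, mul_div_cancel_right₀ _ hc']⟩)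
      (fun x _ => hnd' x)
  let F : OscVec m →ₗ[ℝ] OscVec n := Fintype.linearCombination ℝ fun p : Fin m × Fin 2 =>
    if p.2 = 0 then e p.1 else f p.1
  have hF : ∀ x, F x = ∑ i, (x (i, 0) • e i + x (i, 1) • f i) := by
    intro x
    simp [F, Fintype.linearCombination_apply, Fintype.sum_prod_type]
  have hfe : ∀ i j, ω' (f j) (e i) = if i = j then -(r i : ℝ) else 0 := fun i j => by
    rw [← halt.neg_eq, hef]
    split_ifs <;> simp
  have hFe : ∀ x i, ω' (F x) (e i) = -(r i * x (i, 1)) := by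
    intro x i
    simp only [hF, map_sum, map_add, map_smul, LinearMap.sum_apply, LinearMap.add_apply,
      LinearMap.smul_apply, smul_eq_mul, hee, hfe]
    simp [mul_comm]
  have hFf : ∀ x i, ω' (F x) (f i) = r i * x (i, 0) := by
    intro x i
    simp only [hF, map_sum, map_add, map_smul, LinearMap.sum_apply, LinearMap.add_apply,
      LinearMap.smul_apply, smul_eq_mul, hff, hef]
    simp [mul_comm]
  have hr' : ∀ i, (r i : ℝ) ≠ 0 := fun i => by exact_mod_cast (hr i).ne'
  have hinj : Function.Injective F := by
    rw [← LinearMap.ker_eq_bot, LinearMap.ker_eq_bot']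
    intro x hx
    ext ⟨i, j⟩
    have h1 := hFe x i
    have h2 := hFf x i
    rw [hx] at h1 h2
    fin_cases j
    · simpa [hr' i] using h2.symm
    · simpa [hr' i] using h1
  -- Injectivity of `F` gives `m ≤ n`. Pairing with the symplectic generators is injective by
  -- `hnd'`, which gives `n ≤ m`.
  let G : OscVec n →ₗ[ℝ] OscVec m := LinearMap.pi fun p =>
    if p.2 = 0 then ω'.flip (e p.1) else ω'.flip (f p.1)
  have hG : Function.Injective G := by
    rw [← LinearMap.ker_eq_bot, LinearMap.ker_eq_bot']
    intro u hu
    refine hnd' u fun y hy => ?_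
    obtain ⟨a, b, rfl⟩ := hcoord y hy
    have h1 : ∀ i, ω' u (e i) = 0 := fun i => congrFun hu (i, 0)
    have h2 : ∀ i, ω' u (f i) = 0 := fun i => congrFun hu (i, 1)
    simp only [map_sum, map_add, map_zsmul, h1, h2, smul_zero, add_zero, Finset.sum_const_zero]
  have hmn : m = n := by
    have h1 := LinearMap.finrank_le_finrank_of_injective hinj
    have h2 := LinearMap.finrank_le_finrank_of_injective hG
    simp at h1 h2
    omega
  subst hmn
  let E : OscVec m ≃ₗ[ℝ] OscVec m := LinearEquiv.ofInjectiveEndo F hinj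
  have hE : ∀ x, E x = F x := fun x => rfl
  have hform : ∀ x y, oscStdForm (fun i => (r i : ℝ)) x y = ω' (F x) (F y) := by
    intro x y
    rw [hF y, map_sum, oscStdForm_apply]
    refine Finset.sum_congr rfl fun i _ => ?_
    rw [map_add, map_smul, map_smul, hFe, hFf]
    simp only [smul_eq_mul]
    ring
  refine ⟨r, E.symm, hr, hrdvd, ?_, ?_, ?_⟩
  · intro x y
    rw [hform, ← hE, ← hE, E.apply_symm_apply, E.apply_symm_apply, hω']
  · rintro ⟨i, j⟩
    rw [LinearEquiv.symm_symm, hE]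
    simp only [F, Fintype.linearCombination_apply_single, one_smul]
    split_ifs
    exacts [he i, hf i]
  · intro x hx p
    obtain ⟨a, b, hab⟩ := hcoord x hx
    have h1 : x = E fun p => if p.2 = 0 then (a p.1 : ℝ) else b p.1 := by
      rw [hE, hF, hab]
      simp only [if_true, one_ne_zero, if_false, Int.cast_smul_eq_zsmul]
    rw [h1, E.symm_apply_apply]
    split_ifs
    exacts [⟨_, rfl⟩, ⟨_, rfl⟩]

/-! ### Isomorphisms between oscillator groups and the normal form of a lattice. -/

theorem IsCocompactLattice.map {G G' : Type*} [Group G] [TopologicalSpace G] [Group G']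
    [TopologicalSpace G'] {L : Subgroup G} (hL : IsCocompactLattice L) (Φ : G ≃ₜ* G') :
    IsCocompactLattice (L.map (Φ : G →* G')) where
  discrete := by
    have := hL.discrete
    exact (Φ.toHomeomorph.image (L : Set G)).symm.isEmbedding.discreteTopology
  cocompact := by
    have := hL.cocompact
    let f : G ⧸ L → G' ⧸ L.map (Φ : G →* G') := Quotient.lift (fun g => (Φ g : G' ⧸ _)) (by
      intro a b hab
      refine QuotientGroup.eq.2 ⟨a⁻¹ * b, QuotientGroup.leftRel_apply.1 hab, ?_⟩
      simp)
    have hf : Continuous f :=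
      Continuous.quotient_lift (QuotientGroup.continuous_mk.comp Φ.continuous) _
    refine (show Function.Surjective f from fun q => ?_).compactSpace hf
    obtain ⟨g, rfl⟩ := QuotientGroup.mk_surjective q
    obtain ⟨g, rfl⟩ := Φ.surjective g
    exact ⟨(g : G ⧸ L), rfl⟩

/-- The matrix is `B' = A (T B) A⁻¹`. The form `ω'(B'·, ·)` is the pullback of `ω(B·, ·)` times `T /
c`; a negative `T` merely exchanges the two kinds of definiteness. -/
theorem IsOscPair.exists_transport {n : ℕ} {ω ω' : LinearMap.BilinForm ℝ (OscVec n)} {B : OscMat n}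
    (h : IsOscPair ω B) (A : OscVec n ≃ₗ[ℝ] OscVec n) {c T : ℝ} (hc : 0 < c) (hT : T ≠ 0)
    (hA : ∀ x y, ω' (A x) (A y) = ω x y / c) :
    ∃ B' : OscMat n, IsOscPair ω' B' ∧
      ∀ t v, oscExp B' (t / T) *ᵥ A v = A (oscExp B t *ᵥ v) := by
  set P : OscMat n := LinearMap.toMatrix' (A : OscVec n →ₗ[ℝ] OscVec n) with hP
  set Q : OscMat n := LinearMap.toMatrix' (A.symm : OscVec n →ₗ[ℝ] OscVec n) with hQ
  have hPm : ∀ v, P *ᵥ v = A v := fun v => by rw [hP, LinearMap.toMatrix'_mulVec]; rfl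
  have hPQ : P * Q = 1 := by
    rw [hP, hQ, ← LinearMap.toMatrix'_comp]
    simp
  have hPu : IsUnit P := IsUnit.of_mul_eq_one Q hPQ
  have hQP : P⁻¹ = Q := Matrix.inv_eq_right_inv hPQ
  have hQP' : Q * P = 1 := mul_eq_one_comm.1 hPQ
  have hB : ∀ v, (P * (T • B) * P⁻¹) *ᵥ A v = T • A (B *ᵥ v) := by
    intro v
    rw [← hPm, Matrix.mulVec_mulVec, Matrix.mul_assoc, hQP, hQP', Matrix.mul_one,
      ← Matrix.mulVec_mulVec, hPm, Matrix.smul_mulVec, map_smul]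
  have halt : ω'.IsAlt := fun x => by
    rw [← A.apply_symm_apply x, hA, h.isAlt.self_eq_zero, zero_div]
  refine ⟨P * (T • B) * P⁻¹, ⟨halt, ?_, ?_, ?_⟩, ?_⟩
  · refine (LinearMap.IsRefl.nondegenerate_iff_separatingLeft halt.isRefl).2 fun x hx => ?_
    have : A.symm x = 0 := h.eq_zero_of_form_eq_zero fun v => by
      have := hx (A v)
      rw [← A.apply_symm_apply x, hA, div_eq_zero_iff] at this
      exact this.resolve_right hc.ne'
    simpa using this
  · intro x y
    obtain ⟨x, rfl⟩ := A.surjective x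
    obtain ⟨y, rfl⟩ := A.surjective y
    rw [hB, hB, map_smul, map_smul, LinearMap.smul_apply, hA, hA, h.skew]
    simp only [smul_eq_mul]
    ring
  · have key : ∀ x, ω' ((P * (T • B) * P⁻¹) *ᵥ A x) (A x) = T / c * ω (B *ᵥ x) x := by
      intro x
      rw [hB, map_smul, LinearMap.smul_apply, hA, smul_eq_mul]
      ring
    have hs : (∀ ξ, ξ ≠ 0 → 0 < T / c * ω (B *ᵥ ξ) ξ) ∨
        (∀ ξ, ξ ≠ 0 → T / c * ω (B *ᵥ ξ) ξ < 0) := by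
      rcases hT.lt_or_gt with hT | hT
      · have := div_neg_of_neg_of_pos hT hc
        exact h.definite.symm.imp (fun hd ξ hξ => mul_pos_of_neg_of_neg this (hd ξ hξ))
          fun hd ξ hξ => mul_neg_of_neg_of_pos this (hd ξ hξ)
      · have := div_pos hT hc
        exact h.definite.imp (fun hd ξ hξ => mul_pos this (hd ξ hξ))
          fun hd ξ hξ => mul_neg_of_pos_of_neg this (hd ξ hξ)
    refine hs.imp (fun hd ξ hξ => ?_) fun hd ξ hξ => ?_ <;>
    · obtain ⟨x, rfl⟩ := A.surjective ξ
      rw [key]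
      exact hd x fun h0 => hξ (by simp [h0])
  · intro t v
    have : (t / T) • (P * (T • B) * P⁻¹) = P * (t • B) * P⁻¹ := by
      rw [← Matrix.smul_mul, ← Matrix.mul_smul, smul_smul, div_mul_cancel₀ _ hT]
    rw [oscExp, this, Matrix.exp_conj _ _ hPu, ← hPm, Matrix.mulVec_mulVec, Matrix.mul_assoc, hQP,
      hQP', Matrix.mul_one, ← Matrix.mulVec_mulVec, hPm, ← oscExp]

/-- Conjugation by an element of a topological group. -/
noncomputable def ContinuousMulEquiv.conj {G : Type*} [Group G] [TopologicalSpace G]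
    [IsTopologicalGroup G] (a : G) : G ≃ₜ* G where
  toMulEquiv := MulAut.conj a
  continuous_toFun := (continuous_const.mul continuous_id).mul continuous_const
  continuous_invFun := (continuous_const.mul continuous_id).mul continuous_const

namespace Osc

variable {n : ℕ} {ω ω' : LinearMap.BilinForm ℝ (OscVec n)} {B B' : OscMat n} {h : IsOscPair ω B}
  {h' : IsOscPair ω' B'}

/-- The isomorphism `(z, ξ, t) ↦ (z / c, A ξ, t / T)`. -/
noncomputable def scaleEquiv (A : OscVec n ≃ₗ[ℝ] OscVec n) {c T : ℝ} (hc : c ≠ 0) (hT : T ≠ 0)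
    (hA : ∀ x y, ω' (A x) (A y) = ω x y / c)
    (hB : ∀ t v, oscExp B' (t / T) *ᵥ A v = A (oscExp B t *ᵥ v)) : Osc h ≃ₜ* Osc h' where
  toFun g := ⟨g.z / c, A g.ξ, g.t / T⟩
  invFun g := ⟨g.z * c, A.symm g.ξ, g.t * T⟩
  left_inv g := by ext <;> simp [hc, hT]
  right_inv g := by ext <;> simp [hc, hT]
  map_mul' g k := by
    ext
    · simp [hB, hA]; ring
    · simp [hB]
    · simp [add_div]
  continuous_toFun := continuous_iff.2 ⟨continuous_z.div_const c,
    A.toLinearMap.continuous_of_finiteDimensional.comp continuous_ξ, continuous_t.div_const T⟩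
  continuous_invFun := continuous_iff.2 ⟨continuous_z.mul continuous_const,
    A.symm.toLinearMap.continuous_of_finiteDimensional.comp continuous_ξ,
    continuous_t.mul continuous_const⟩

/-- The automorphism `(z, ξ, t) ↦ (z + κ t, ξ, t)`. -/
noncomputable def shearEquiv (h : IsOscPair ω B) (κ : ℝ) : Osc h ≃ₜ* Osc h where
  toFun g := ⟨g.z + κ * g.t, g.ξ, g.t⟩
  invFun g := ⟨g.z - κ * g.t, g.ξ, g.t⟩
  left_inv g := by ext <;> simp
  right_inv g := by ext <;> simp
  map_mul' g k := by
    ext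
    · simp; ring
    · simp
    · simp
  continuous_toFun := continuous_iff.2 ⟨continuous_z.add (continuous_const.mul continuous_t),
    continuous_ξ, continuous_t⟩
  continuous_invFun := continuous_iff.2 ⟨continuous_z.sub (continuous_const.mul continuous_t),
    continuous_ξ, continuous_t⟩

theorem conj_of_t_eq_zero (η : OscVec n) {g : Osc h} (hg : g.t = 0) :
    ContinuousMulEquiv.conj (⟨0, η, 0⟩ : Osc h) g = ⟨g.z + ω η g.ξ, g.ξ, 0⟩ := by
  have h1 : ContinuousMulEquiv.conj (⟨0, η, 0⟩ : Osc h) g = ⁅(⟨0, η, 0⟩ : Osc h), g⁆ * g := by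
    rw [commutatorElement_def, inv_mul_cancel_right]
    rfl
  rw [h1, commutator_of_t_eq_zero rfl hg]
  ext i <;> simp [hg, oscExp_zero, add_comm]

theorem conj_t (a g : Osc h) : (ContinuousMulEquiv.conj a g).t = g.t := by
  change (a * g * a⁻¹).t = g.t
  simp

theorem one_mem_zSubgroup_gammaSubgroup : (1 : ℝ) ∈ zSubgroup (gammaSubgroup h) :=
  Subgroup.subset_closure (Or.inl rfl)

theorem mem_ξSubgroup_gammaSubgroup {v : OscVec n} (hv : ∀ i, ∃ a : ℤ, v i = a) :
    v ∈ ξSubgroup (gammaSubgroup h) := by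
  choose a ha using hv
  have h1 : v = ∑ i, a i • (Pi.single i 1 : OscVec n) := by
    ext j
    simp [ha, Finset.sum_apply, Pi.single_apply]
  rw [h1]
  have h2 : ∀ i, (Pi.single i 1 : OscVec n) ∈ ξSubgroup (gammaSubgroup h) := fun i =>
    ⟨0, Subgroup.subset_closure (Or.inr ⟨i, rfl⟩)⟩
  exact sum_mem fun i _ => zsmul_mem (h2 i) _

/-- An element of `M ∩ H` agrees with some element of the standard group up to an integral central
factor, and multiplication by a power of `(0, ξ₀, 1)` moves any element of `M` into `H`. -/
theorem isLatticeOf_of_mem {M : Subgroup (Osc h)} (hM : IsCocompactLattice M) {ξ₀ : OscVec n}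
    (hz : ∀ z, z ∈ zSubgroup M ↔ ∃ k : ℤ, z = k)
    (he : ∀ i, (⟨0, Pi.single i 1, 0⟩ : Osc h) ∈ M)
    (hξ : ∀ v ∈ ξSubgroup M, ∀ i, ∃ a : ℤ, v i = a)
    (ht : ∀ g ∈ M, ∃ k : ℤ, g.t = k) (h1 : (⟨0, ξ₀, 1⟩ : Osc h) ∈ M) : IsLatticeOf M ξ₀ := by
  have hle : gammaSubgroup h ≤ M := by
    refine (Subgroup.closure_le _).2 (Set.union_subset ?_ ?_)
    · rintro _ rfl
      exact (hz 1).2 ⟨1, by simp⟩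
    · rintro _ ⟨i, rfl⟩
      exact he i
  have hinf : M ⊓ heis h = gammaSubgroup h := by
    refine le_antisymm ?_ (le_inf hle ?_)
    · rintro g ⟨hgM, hgt⟩
      obtain ⟨γ, hγ, hγt, hγξ⟩ := mem_ξSubgroup.1 (mem_ξSubgroup_gammaSubgroup (h := h)
        (hξ _ (mem_ξSubgroup.2 ⟨g, hgM, hgt, rfl⟩)))
      have h2 : γ⁻¹ * g = ⟨(γ⁻¹ * g).z, 0, 0⟩ := by
        have hgt : g.t = 0 := hgt
        ext i <;> simp [hγt, hgt, hγξ, oscExp_zero]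
      obtain ⟨k, hk⟩ := (hz (γ⁻¹ * g).z).1 (by
        rw [mem_zSubgroup, ← h2]
        exact M.mul_mem (M.inv_mem (hle hγ)) hgM)
      have h3 : γ⁻¹ * g ∈ gammaSubgroup h := by
        have := zsmul_mem (one_mem_zSubgroup_gammaSubgroup (h := h)) k
        rw [zsmul_one, ← hk, mem_zSubgroup] at this
        rwa [h2]
      simpa using mul_mem hγ h3
    · refine (Subgroup.closure_le _).2 (Set.union_subset ?_ ?_)
      · rintro _ rfl
        rfl
      · rintro _ ⟨i, rfl⟩
        rfl
  refine ⟨le_antisymm ?_ ?_, hM, hinf⟩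
  · intro g hg
    obtain ⟨k, hk⟩ := ht g hg
    have hx : (⟨0, ξ₀, 1⟩ : Osc h) ∈ gammaExt h ξ₀ := Subgroup.subset_closure (Or.inr rfl)
    have h2 : g * (⟨0, ξ₀, 1⟩ : Osc h) ^ (-k) ∈ gammaExt h ξ₀ := by
      refine Subgroup.subset_closure (Or.inl ?_)
      rw [SetLike.mem_coe, ← hinf]
      exact ⟨M.mul_mem hg (M.zpow_mem h1 _), show (_ : Osc h).t = 0 by simp [hk]⟩
    simpa using mul_mem h2 (zpow_mem hx k)
  · refine (Subgroup.closure_le _).2 (Set.union_subset hle ?_)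
    rintro _ rfl
    exact h1

theorem exists_isLatticeOf (hn : 1 ≤ n) {L : Subgroup (Osc h)} (hL : IsCocompactLattice L) :
    ∃ r : Fin n → ℕ, (∀ i, 0 < r i) ∧
      (∀ (i : ℕ) (hi : i + 1 < n), r ⟨i, Nat.lt_of_succ_lt hi⟩ ∣ r ⟨i + 1, hi⟩) ∧
      ∃ (B' : OscMat n) (h' : IsOscPair (oscStdForm fun i => (r i : ℝ)) B')
        (Φ : Osc h ≃ₜ* Osc h') (ξ₀ : OscVec n),
        IsLatticeOf (L.map (Φ : Osc h →* Osc h')) ξ₀ := by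
  have := hL.discrete
  have := hL.cocompact
  obtain ⟨T, hT0, hT⟩ := exists_tSubgroup_generator hn hL
  have hs := eq_zero_of_form_ξSubgroup_eq_zero hT0 hT
  obtain ⟨c, hc, hz⟩ := exists_zSubgroup_eq hn hs
  obtain ⟨r, A, hr, hrdvd, hA, hbasis, hint⟩ := exists_standard_coordinates h.isAlt (ξSubgroup L) hc
    (fun x hx y hy => (hz _).1 (form_mem_zSubgroup hx hy)) hs
  obtain ⟨B', h', hB'⟩ := h.exists_transport A hc hT0 hA
  have hr' : ∀ i, (r i : ℝ) ≠ 0 := fun i => by exact_mod_cast (hr i).ne'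
  choose y hy using hbasis
  -- After rescaling, the lift of the `i`-th basis vector has central coordinate `y i / c`.
  -- Conjugation by `(0, η, 0)` adds `ω_r(η, e_i)` to it, and `η` is chosen to cancel.
  let η : OscVec n := fun p => if p.2 = 0 then -(y (p.1, 1) / c / r p.1) else y (p.1, 0) / c / r p.1
  have hη : ∀ i, oscStdForm (fun i => (r i : ℝ)) η (Pi.single i 1) = -(y i / c) := by
    rintro ⟨i, j⟩
    fin_cases j
    · refine (oscStdForm_single_zero _ _ _).trans ?_
      simp [η, mul_div_cancel₀, hr']
    · refine (oscStdForm_single_one _ _ _).trans ?_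
      simp [η, mul_div_cancel₀, hr']
  obtain ⟨x, hx, hxT⟩ := (mem_tSubgroup (L := L)).1 ((hT T).2 ⟨1, by simp⟩)
  let Φ₁ : Osc h ≃ₜ* Osc h' := (scaleEquiv A hc.ne' hT0 hA hB').trans
    (ContinuousMulEquiv.conj ⟨0, η, 0⟩)
  -- The shear fixes `H` pointwise, so the normalization of the basis survives. As `(Φ₁ x).t = 1`,
  -- it removes the central coordinate of the image of `x`.
  let Φ : Osc h ≃ₜ* Osc h' := Φ₁.trans (shearEquiv h' (-(Φ₁ x).z))
  have hΦ₁t : ∀ g, (Φ₁ g).t = g.t / T := fun g => conj_t _ _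
  have hΦt : ∀ g, (Φ g).t = g.t / T := hΦ₁t
  have hΦ0 : ∀ g, g.t = 0 →
      Φ g = ⟨g.z / c + oscStdForm (fun i => (r i : ℝ)) η (A g.ξ), A g.ξ, 0⟩ := by
    intro g hg
    have h1 : Φ₁ g = ⟨g.z / c + oscStdForm (fun i => (r i : ℝ)) η (A g.ξ), A g.ξ, 0⟩ :=
      conj_of_t_eq_zero η (g := scaleEquiv A hc.ne' hT0 hA hB' g)
        (show g.t / T = 0 by rw [hg, zero_div])
    change shearEquiv h' (-(Φ₁ x).z) (Φ₁ g) = _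
    rw [h1]
    ext i <;> simp [shearEquiv]
  have hΦt0 : ∀ g, (Φ g).t = 0 → g.t = 0 := fun g hg => by
    rw [hΦt, div_eq_zero_iff] at hg
    exact hg.resolve_right hT0
  refine ⟨r, hr, hrdvd, B', h', Φ, (Φ x).ξ, isLatticeOf_of_mem (hL.map Φ) ?_ ?_ ?_ ?_ ?_⟩
  · intro z
    constructor
    · rintro ⟨l, hl, hlz⟩
      change Φ l = _ at hlz
      have h1 := hΦt0 l (by rw [hlz])
      rw [hΦ0 l h1, Osc.mk.injEq] at hlz
      have h2 : l.ξ = 0 := by simpa using hlz.2.1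
      obtain ⟨k, hk⟩ := (hz l.z).1 (by
        have h3 : l = ⟨l.z, 0, 0⟩ := by ext i <;> simp [h1, h2]
        rw [mem_zSubgroup, ← h3]
        exact hl)
      refine ⟨k, ?_⟩
      rw [← hlz.1, h2, hk]
      simp [hc.ne']
    · rintro ⟨k, rfl⟩
      refine ⟨⟨k * c, 0, 0⟩, (hz _).2 ⟨k, rfl⟩, ?_⟩
      change Φ _ = _
      rw [hΦ0 _ rfl]
      ext i <;> simp [hc.ne']
  · intro i
    refine ⟨_, hy i, ?_⟩
    change Φ _ = _
    rw [hΦ0 _ rfl]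
    ext j <;> simp [hη]
  · intro v hv
    obtain ⟨_, ⟨l, hl, rfl⟩, h1, h2⟩ := mem_ξSubgroup.1 hv
    change (Φ l).t = 0 at h1
    change (Φ l).ξ = v at h2
    have h3 := hΦt0 l h1
    rw [hΦ0 l h3] at h2
    rw [← h2]
    exact hint _ (mem_ξSubgroup.2 ⟨l, hl, h3, rfl⟩)
  · rintro _ ⟨l, hl, rfl⟩
    obtain ⟨k, hk⟩ := (hT l.t).1 ⟨l, hl, rfl⟩
    exact ⟨k, by change (Φ l).t = k; rw [hΦt, hk, mul_div_cancel_right₀ _ hT0]⟩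
  · refine ⟨x, hx, ?_⟩
    change Φ x = _
    have h1 : (Φ₁ x).t = 1 := by rw [hΦ₁t, hxT, div_self hT0]
    ext i
    · change (Φ₁ x).z + -(Φ₁ x).z * (Φ₁ x).t = 0
      rw [h1]
      ring
    · rfl
    · exact h1

end Osc

/-! ### Group-theoretic and arithmetic invariants for uniqueness. -/

/-- The image of `φ` is the product of the cyclic subgroups of `ℤ/m` generated by the `s i`, of
orders `m / gcd(m, s i)`. -/
theorem ZMod.index_ker_pi_intCast {ι : Type*} [Fintype ι] {G : Type*} [Group G] (m : ℕ) [NeZero m]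
    (s : ι → ℕ) (f : G → ι → ℤ) (hf : Function.Surjective f)
    (φ : G →* Multiplicative (ι → ZMod m))
    (hφ : ∀ g, φ g = Multiplicative.ofAdd fun i => ((s i * f g i : ℤ) : ZMod m)) :
    φ.ker.index = ∏ i, m / m.gcd (s i) := by
  rw [Subgroup.index_ker]
  have h1 : (φ.range : Set (Multiplicative (ι → ZMod m))) =
      Multiplicative.toAdd ⁻¹' Set.univ.pi fun i =>
        (AddSubgroup.zmultiples (s i : ZMod m) : Set (ZMod m)) := by
    ext x
    simp only [SetLike.mem_coe, MonoidHom.mem_range, Set.mem_preimage, Set.mem_univ_pi,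
      AddSubgroup.mem_zmultiples_iff]
    constructor
    · rintro ⟨g, rfl⟩ i
      exact ⟨f g i, by simp [hφ, mul_comm]⟩
    · intro hx
      choose k hk using hx
      obtain ⟨g, rfl⟩ := hf k
      refine ⟨g, ?_⟩
      rw [hφ]
      apply Multiplicative.toAdd.injective
      ext i
      rw [← hk]
      simp [mul_comm]
  have h2 : Nat.card φ.range = Nat.card (Set.univ.pi fun i =>
      (AddSubgroup.zmultiples (s i : ZMod m) : Set (ZMod m))) := by
    change Nat.card (φ.range : Set (Multiplicative (ι → ZMod m))) = _
    rw [h1]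
    rfl
  rw [h2, Nat.card_congr (Equiv.Set.univPi _), Nat.card_pi]
  refine Finset.prod_congr rfl fun i _ => ?_
  change Nat.card (AddSubgroup.zmultiples (s i : ZMod m)) = _
  rw [Nat.card_zmultiples, ZMod.addOrderOf_coe _ (NeZero.ne m)]

theorem eq_of_prod_div_gcd_eq {n : ℕ} {r s : Fin n → ℕ} (hr : ∀ i, 0 < r i) (hs : ∀ i, 0 < s i)
    (hrd : ∀ i j, i ≤ j → r i ∣ r j) (hsd : ∀ i j, i ≤ j → s i ∣ s j)
    (heq : ∀ m, 0 < m → ∏ i, m / m.gcd (r i) = ∏ i, m / m.gcd (s i)) : r = s := by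
  have key : ∀ {r s : Fin n → ℕ}, (∀ i, 0 < r i) → (∀ i j, i ≤ j → r i ∣ r j) →
      (∀ m, 0 < m → ∏ i, m / m.gcd (r i) = ∏ i, m / m.gcd (s i)) →
      ∀ i, (∀ j < i, r j = s j) → r i ∣ s i := by
    intro r s hr hrd heq i hi
    have hdiv : ∀ a, 0 < r i / (r i).gcd a := fun a =>
      Nat.div_pos (Nat.le_of_dvd (hr i) (Nat.gcd_dvd_left _ _)) (Nat.gcd_pos_of_pos_left _ (hr i))
    -- With `m = r i` the factors of `r` at `j ≥ i` equal `1`, and those at `j < i` agree with the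
    -- factors of `s`. Equal products thus force equality in each factor; the one at `i` gives `r i
    -- ∣ s i`.
    have h1 := heq (r i) (hr i)
    have h2 : ∀ j ∈ Finset.univ, r i / (r i).gcd (r j) ≤ r i / (r i).gcd (s j) := by
      intro j _
      rcases lt_or_ge j i with hj | hj
      · rw [hi j hj]
      · rw [Nat.gcd_eq_left (hrd i j hj), Nat.div_self (hr i)]
        exact hdiv _
    have h3 : r i / (r i).gcd (r i) = r i / (r i).gcd (s i) := by
      by_contra hne
      refine h1.not_lt (Finset.prod_lt_prod (fun j _ => hdiv _) h2 ⟨i, Finset.mem_univ _,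
        lt_of_le_of_ne (h2 i (Finset.mem_univ _)) hne⟩)
    rw [Nat.gcd_self, Nat.div_self (hr i)] at h3
    have h4 := Nat.div_mul_cancel (Nat.gcd_dvd_left (r i) (s i))
    rw [← h3, one_mul] at h4
    exact h4 ▸ Nat.gcd_dvd_right _ _
  have : ∀ i, r i = s i := fun i => by
    refine WellFoundedLT.induction (motive := fun i => r i = s i) i fun i ih => ?_
    exact Nat.dvd_antisymm (key hr hrd heq i ih)
      (key hs hsd (fun m hm => (heq m hm).symm) i fun j hj => (ih j hj).symm)
  exact funext this

/-- The elements of a group all of whose commutators are `m`-th powers of central elements. -/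
def commutatorPowSet (G : Type*) [Group G] (m : ℕ) : Set G :=
  {g | ∀ k : G, ∃ c ∈ Subgroup.center G, ⁅g, k⁆ = c ^ m}

theorem MulEquiv.mem_commutatorPowSet {G G' : Type*} [Group G] [Group G'] (e : G ≃* G') {m : ℕ}
    {g : G} (hg : g ∈ commutatorPowSet G m) : e g ∈ commutatorPowSet G' m := by
  intro k
  obtain ⟨c, hc, hck⟩ := hg (e.symm k)
  refine ⟨e c, ?_, ?_⟩
  · rw [Subgroup.mem_center_iff] at hc ⊢
    intro x
    apply e.symm.injective
    simpa using hc (e.symm x)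
  · rw [← map_pow, ← hck, map_commutatorElement, e.apply_symm_apply]

theorem MulEquiv.mem_commutatorPowSet_iff {G G' : Type*} [Group G] [Group G'] (e : G ≃* G') {m : ℕ}
    {g : G} : e g ∈ commutatorPowSet G' m ↔ g ∈ commutatorPowSet G m :=
  ⟨fun hg => by simpa using e.symm.mem_commutatorPowSet hg, e.mem_commutatorPowSet⟩

namespace Osc

/-! ### The Heisenberg group as commutator subgroup. -/

section commutator

variable {n : ℕ} {ω ω' : LinearMap.BilinForm ℝ (OscVec n)} {B B' : OscMat n} {h : IsOscPair ω B}
  {h' : IsOscPair ω' B'}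

/-- A functional vanishing on these ranges is some `ω(u, ·)` invariant under `e^{tB}`; the
derivative at `0` gives `Bu = 0`. The ranges consist of `ξ`-components of commutators of `(0, 0, t)`
and `(0, w, 0)`. -/
theorem iSup_range_oscExp_sub_id (h : IsOscPair ω B) :
    ⨆ t : ℝ, LinearMap.range ((oscExp B t).mulVecLin - LinearMap.id) = ⊤ := by
  by_contra hne
  obtain ⟨f, hf0, hf⟩ := Submodule.exists_le_ker_of_lt_top _ (lt_top_iff_ne_top.2 hne)
  obtain ⟨u, rfl⟩ := (LinearMap.BilinForm.toDual ω h.nondegenerate).surjective f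
  have key : ∀ v t, ω u (oscExp B t *ᵥ v) = ω u v := by
    intro v t
    have h1 : ((oscExp B t).mulVecLin - LinearMap.id : OscVec n →ₗ[ℝ] OscVec n) v ∈
        ⨆ t : ℝ, LinearMap.range ((oscExp B t).mulVecLin - LinearMap.id) :=
      Submodule.mem_iSup_of_mem t ⟨v, rfl⟩
    have h2 : ω u (((oscExp B t).mulVecLin - LinearMap.id : OscVec n →ₗ[ℝ] OscVec n) v) = 0 :=
      hf h1
    simpa [sub_eq_zero] using h2
  refine hf0 ?_
  rw [h.eq_zero_of_mulVec_eq_zero (h.eq_zero_of_form_eq_zero fun v => ?_) (u := u), map_zero]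
  have hd := hasDerivAt_form_oscExp ω B u v
  simp only [key] at hd
  rw [h.skew, hd.unique (hasDerivAt_const 0 _), neg_zero]

theorem commutator_eq_heis (hn : 1 ≤ n) : commutator (Osc h) = heis h := by
  refine le_antisymm ?_ ?_
  · intro g hg
    have := Abelianization.commutator_subset_ker (tHom h) hg
    exact this
  · have hmem : ∀ g k : Osc h, ⁅g, k⁆ ∈ commutator (Osc h) := fun g k =>
      Subgroup.commutator_mem_commutator (Subgroup.mem_top g) (Subgroup.mem_top k)
    have hξ : ∀ v, v ∈ ξSubgroup (commutator (Osc h)) := by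
      intro v
      have hv : v ∈ ⨆ t : ℝ, LinearMap.range ((oscExp B t).mulVecLin - LinearMap.id) := by
        rw [iSup_range_oscExp_sub_id h]
        trivial
      refine Submodule.iSup_induction _ (motive := (· ∈ ξSubgroup (commutator (Osc h)))) hv ?_
        (zero_mem _) fun _ _ => add_mem
      rintro t _ ⟨w, rfl⟩
      refine mem_ξSubgroup.2 ⟨_, hmem ⟨0, 0, t⟩ ⟨0, w, 0⟩, commutator_t _ _, ?_⟩
      rw [commutator_ξ]
      simp
    have hz : ∀ z, z ∈ zSubgroup (commutator (Osc h)) := by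
      intro z
      obtain ⟨v, w, hvw⟩ : ∃ v w, ω v w ≠ 0 := by
        by_contra! hcon
        have := h.eq_zero_of_form_eq_zero (hcon (Pi.single (⟨0, hn⟩, 0) 1))
        simpa using congrFun this (⟨0, hn⟩, 0)
      have := form_mem_zSubgroup (hξ ((z / ω v w) • v)) (hξ w)
      rwa [map_smul, LinearMap.smul_apply, smul_eq_mul, div_mul_cancel₀ _ hvw] at this
    rintro ⟨z, ξ, t⟩ hg
    obtain rfl : t = 0 := hg
    obtain ⟨y, hy⟩ := hξ ξ
    have := (commutator (Osc h)).mul_mem (hz (z - y)) hy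
    simpa [mul_def, oscExp_zero] using this

theorem map_heis (hn : 1 ≤ n) (Ψ : Osc h ≃* Osc h') :
    (heis h).map (Ψ : Osc h →* Osc h') = heis h' := by
  rw [← commutator_eq_heis hn, ← commutator_eq_heis hn, commutator_def, Subgroup.map_commutator,
    Subgroup.map_top_of_surjective _ Ψ.surjective, commutator_def]

end commutator

/-! ### The discrete Heisenberg groups `Γ_r` and their index invariants. -/

section standard

variable {n : ℕ} {r : Fin n → ℕ} {B : OscMat n}
  {h : IsOscPair (oscStdForm fun i => (r i : ℝ)) B}

theorem t_eq_zero_of_mem_gammaSubgroup {g : Osc h} (hg : g ∈ gammaSubgroup h) : g.t = 0 := by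
  have : gammaSubgroup h ≤ heis h := by
    refine (Subgroup.closure_le _).2 (Set.union_subset ?_ ?_)
    · rintro _ rfl
      rfl
    · rintro _ ⟨i, rfl⟩
      rfl
  exact this hg

/-- The half-integral correction depends only on `ξ` and vanishes at `ξ = 0`, so central coordinates
of elements of `Γ_r` with `ξ = 0` are integers. -/
theorem exists_int_of_mem_gammaSubgroup {g : Osc h} (hg : g ∈ gammaSubgroup h) :
    ∃ (a : Fin n × Fin 2 → ℤ) (k : ℤ), (∀ p, g.ξ p = a p) ∧
      g.z = k + (1 / 2) * ∑ i, (r i : ℝ) * (a (i, 0) * a (i, 1)) := by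
  classical
  induction hg using Subgroup.closure_induction with
  | mem x hx =>
    rcases hx with rfl | ⟨⟨i, j⟩, rfl⟩
    · exact ⟨0, 1, by simp, by simp⟩
    · refine ⟨Pi.single (i, j) 1, 0, fun p => by simp [Pi.single_apply], ?_⟩
      have : ∀ l, ((Pi.single (i, j) 1 : Fin n × Fin 2 → ℤ) (l, 0) : ℝ) *
          ((Pi.single (i, j) 1 : Fin n × Fin 2 → ℤ) (l, 1) : ℝ) = 0 := by
        intro l
        fin_cases j <;> simp [Pi.single_apply]
      simp [this]
  | one => exact ⟨0, 0, by simp, by simp⟩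
  | mul x y hx hy ihx ihy =>
    obtain ⟨a, k, ha, hk⟩ := ihx
    obtain ⟨b, l, hb, hl⟩ := ihy
    -- The cocycle `(a₀b₁ - a₁b₀) / 2` differs from the polarization `(a₀b₁ + a₁b₀) / 2` of the
    -- correction term by the integer `a₁b₀`.
    refine ⟨a + b, k + l - ∑ i, r i * (a (i, 1) * b (i, 0)), fun p => ?_, ?_⟩
    · simp [t_eq_zero_of_mem_gammaSubgroup hx, oscExp_zero, ha, hb]
    · simp only [mul_z, t_eq_zero_of_mem_gammaSubgroup hx, oscExp_zero, one_mulVec, hk, hl,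
        oscStdForm_apply, ha, hb]
      push_cast
      simp only [Pi.add_apply, Int.cast_add]
      have : ∑ i, (r i : ℝ) * ((a (i, 0) + b (i, 0)) * (a (i, 1) + b (i, 1))) =
          ∑ i, (r i : ℝ) * (a (i, 0) * a (i, 1)) + ∑ i, (r i : ℝ) * (b (i, 0) * b (i, 1)) +
          ∑ i, (r i : ℝ) * (a (i, 0) * b (i, 1) - a (i, 1) * b (i, 0)) +
          2 * ∑ i, (r i : ℝ) * (a (i, 1) * b (i, 0)) := by
        rw [Finset.mul_sum, ← Finset.sum_add_distrib, ← Finset.sum_add_distrib,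
          ← Finset.sum_add_distrib]
        exact Finset.sum_congr rfl fun i _ => by ring
      rw [this]
      ring
  | inv x hx ih =>
    obtain ⟨a, k, ha, hk⟩ := ih
    refine ⟨-a, -k - ∑ i, r i * (a (i, 0) * a (i, 1)), fun p => ?_, ?_⟩
    · simp [t_eq_zero_of_mem_gammaSubgroup hx, oscExp_zero, ha]
    · simp [hk]
      ring

theorem mk_intCast_mem_gammaSubgroup (k : ℤ) : (⟨k, 0, 0⟩ : Osc h) ∈ gammaSubgroup h := by
  have := zsmul_mem (one_mem_zSubgroup_gammaSubgroup (h := h)) k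
  rwa [zsmul_one, mem_zSubgroup] at this

theorem exists_mem_gammaSubgroup (a : Fin n × Fin 2 → ℤ) :
    ∃ g ∈ gammaSubgroup h, g.t = 0 ∧ g.ξ = fun p => (a p : ℝ) :=
  mem_ξSubgroup.1 (mem_ξSubgroup_gammaSubgroup fun p => ⟨a p, rfl⟩)

theorem mk_pow (z : ℝ) (m : ℕ) : (⟨z, 0, 0⟩ : Osc h) ^ m = ⟨m * z, 0, 0⟩ := by
  induction m with
  | zero => ext i <;> simp
  | succ m ih =>
    rw [pow_succ, ih]
    ext i
    · simp; ring
    · simp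
    · simp

theorem commutator_gammaSubgroup (g k : gammaSubgroup h) :
    ((⁅g, k⁆ : gammaSubgroup h) : Osc h) =
      ⟨oscStdForm (fun i => (r i : ℝ)) g.1.ξ k.1.ξ, 0, 0⟩ :=
  commutator_of_t_eq_zero (t_eq_zero_of_mem_gammaSubgroup g.2) (t_eq_zero_of_mem_gammaSubgroup k.2)

theorem mem_center_gammaSubgroup (hr : ∀ i, 0 < r i) {g : gammaSubgroup h} :
    g ∈ Subgroup.center (gammaSubgroup h) ↔ ∃ k : ℤ, (g : Osc h) = ⟨k, 0, 0⟩ := by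
  have hr' : ∀ i, (r i : ℝ) ≠ 0 := fun i => by exact_mod_cast (hr i).ne'
  have hc : g ∈ Subgroup.center (gammaSubgroup h) ↔
      ∀ k : gammaSubgroup h, oscStdForm (fun i => (r i : ℝ)) g.1.ξ k.1.ξ = 0 := by
    rw [Subgroup.mem_center_iff]
    refine forall_congr' fun k => ?_
    rw [eq_comm, ← commutatorElement_eq_one_iff_mul_comm, Subtype.ext_iff, commutator_gammaSubgroup,
      Subgroup.coe_one, one_def, Osc.mk.injEq]
    simp
  rw [hc]
  constructor
  · intro hg
    obtain ⟨a, k, ha, hk⟩ := exists_int_of_mem_gammaSubgroup g.2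
    have h1 : ∀ p, oscStdForm (fun i => (r i : ℝ)) g.1.ξ (Pi.single p 1) = 0 := fun p =>
      hg ⟨⟨0, Pi.single p 1, 0⟩, Subgroup.subset_closure (Or.inr ⟨p, rfl⟩)⟩
    have h2 : g.1.ξ = 0 := by
      ext ⟨i, j⟩
      fin_cases j
      · simpa [oscStdForm_single_one, hr'] using h1 (i, 1)
      · simpa [oscStdForm_single_zero, hr'] using h1 (i, 0)
    have h3 : ∀ p, (a p : ℝ) = 0 := fun p => by rw [← ha, h2]; rfl
    refine ⟨k, ?_⟩
    ext p
    · simp [hk, h3]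
    · simp [h2]
    · exact t_eq_zero_of_mem_gammaSubgroup g.2
  · rintro ⟨k, hk⟩ l
    simp [hk]

/-- The `m`-th powers of central elements are the `(mk, 0, 0)`. Testing against the basis vectors
turns the condition into `m ∣ r_i a` for both coordinates of each pair, hence the square in the
index. -/
theorem exists_index_commutatorPowSet (hr : ∀ i, 0 < r i) (m : ℕ) (hm : 0 < m) :
    ∃ K : Subgroup (gammaSubgroup h), (K : Set (gammaSubgroup h)) =
      commutatorPowSet (gammaSubgroup h) m ∧ K.index = (∏ i, m / m.gcd (r i)) ^ 2 := by
  have : NeZero m := ⟨hm.ne'⟩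
  choose a ha using fun g : gammaSubgroup h => exists_int_of_mem_gammaSubgroup g.2
  have hξ : ∀ g p, g.1.ξ p = a g p := fun g p => (ha g).choose_spec.1 p
  have hmul : ∀ g k, a (g * k) = a g + a k := by
    intro g k
    ext p
    have h1 := hξ (g * k) p
    rw [Subgroup.coe_mul, mul_ξ, t_eq_zero_of_mem_gammaSubgroup g.2, oscExp_zero, one_mulVec,
      Pi.add_apply, hξ, hξ] at h1
    exact_mod_cast h1.symm
  have hsurj : Function.Surjective a := by
    intro b
    obtain ⟨g, hg, -, hgb⟩ := exists_mem_gammaSubgroup (h := h) b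
    refine ⟨⟨g, hg⟩, ?_⟩
    ext p
    have h1 := hξ ⟨g, hg⟩ p
    rw [hgb] at h1
    exact (Int.cast_injective (α := ℝ) h1).symm
  let φ : gammaSubgroup h →* Multiplicative (Fin n × Fin 2 → ZMod m) :=
    MonoidHom.mk' (fun g => Multiplicative.ofAdd fun p => ((r p.1 * a g p : ℤ) : ZMod m)) (by
      intro g k
      rw [← ofAdd_add]
      congr 1
      ext p
      simp [hmul, mul_add])
  refine ⟨φ.ker, ?_, ?_⟩
  · ext g
    have h1 : g ∈ φ.ker ↔ ∀ p, (m : ℤ) ∣ r p.1 * a g p := by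
      rw [MonoidHom.mem_ker]
      refine (Multiplicative.toAdd.injective.eq_iff.symm.trans funext_iff).trans
        (forall_congr' fun p => ?_)
      exact ZMod.intCast_zmod_eq_zero_iff_dvd _ _
    have hpow : ∀ k : ℤ, (⟨⟨k, 0, 0⟩, mk_intCast_mem_gammaSubgroup k⟩ : gammaSubgroup h) ^ m =
        ⟨⟨(m * k : ℤ), 0, 0⟩, mk_intCast_mem_gammaSubgroup _⟩ := by
      intro k
      apply Subtype.ext
      rw [Subgroup.coe_pow, mk_pow]
      push_cast
      rfl
    have h2 : g ∈ commutatorPowSet (gammaSubgroup h) m ↔ ∀ k : gammaSubgroup h,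
        ∃ l : ℤ, oscStdForm (fun i => (r i : ℝ)) g.1.ξ k.1.ξ = (m * l : ℤ) := by
      refine forall_congr' fun k => ?_
      constructor
      · rintro ⟨c, hc, hck⟩
        obtain ⟨l, hl⟩ := (mem_center_gammaSubgroup hr).1 hc
        obtain rfl : c = ⟨⟨l, 0, 0⟩, mk_intCast_mem_gammaSubgroup l⟩ := Subtype.ext hl
        rw [hpow, Subtype.ext_iff, commutator_gammaSubgroup, Osc.mk.injEq] at hck
        exact ⟨l, hck.1⟩
      · rintro ⟨l, hl⟩
        refine ⟨⟨⟨l, 0, 0⟩, mk_intCast_mem_gammaSubgroup l⟩,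
          (mem_center_gammaSubgroup hr).2 ⟨l, rfl⟩, ?_⟩
        rw [hpow, Subtype.ext_iff, commutator_gammaSubgroup, hl]
    rw [h2, SetLike.mem_coe, h1]
    constructor
    · intro hg k
      have h3 : oscStdForm (fun i => (r i : ℝ)) g.1.ξ k.1.ξ =
          ((∑ i, (r i * a g (i, 0) * a k (i, 1) - r i * a g (i, 1) * a k (i, 0)) : ℤ) : ℝ) := by
        rw [oscStdForm_apply]
        push_cast
        exact Finset.sum_congr rfl fun i _ => by rw [hξ, hξ, hξ, hξ]; ring
      obtain ⟨l, hl⟩ : (m : ℤ) ∣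
          ∑ i, (r i * a g (i, 0) * a k (i, 1) - r i * a g (i, 1) * a k (i, 0)) :=
        Finset.dvd_sum fun i _ => dvd_sub (Dvd.dvd.mul_right (hg (i, 0)) _)
          (Dvd.dvd.mul_right (hg (i, 1)) _)
      exact ⟨l, by rw [h3, hl]⟩
    · rintro hg ⟨i, j⟩
      fin_cases j
      · obtain ⟨l, hl⟩ := hg ⟨⟨0, Pi.single (i, 1) 1, 0⟩,
          Subgroup.subset_closure (Or.inr ⟨(i, 1), rfl⟩)⟩
        rw [oscStdForm_single_one, hξ] at hl
        exact ⟨l, by exact_mod_cast hl⟩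
      · obtain ⟨l, hl⟩ := hg ⟨⟨0, Pi.single (i, 0) 1, 0⟩,
          Subgroup.subset_closure (Or.inr ⟨(i, 0), rfl⟩)⟩
        rw [oscStdForm_single_zero, hξ] at hl
        have : -((r i : ℤ) * a g (i, 1)) = m * l := by exact_mod_cast hl
        exact dvd_neg.1 ⟨l, this⟩
  · rw [ZMod.index_ker_pi_intCast m (fun p : Fin n × Fin 2 => r p.1) a hsurj φ fun g => rfl,
      Fintype.prod_prod_type]
    simp [Finset.prod_pow]

end standard

theorem eq_of_gammaSubgroup_mulEquiv {n : ℕ} {r s : Fin n → ℕ} {B B' : OscMat n}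
    {h : IsOscPair (oscStdForm fun i => (r i : ℝ)) B}
    {h' : IsOscPair (oscStdForm fun i => (s i : ℝ)) B'} (hr : ∀ i, 0 < r i) (hs : ∀ i, 0 < s i)
    (hrd : ∀ i j, i ≤ j → r i ∣ r j) (hsd : ∀ i j, i ≤ j → s i ∣ s j)
    (e : gammaSubgroup h ≃* gammaSubgroup h') : r = s := by
  refine eq_of_prod_div_gcd_eq hr hs hrd hsd fun m hm => ?_
  obtain ⟨K, hK, hKi⟩ := exists_index_commutatorPowSet (h := h) hr m hm
  obtain ⟨K', hK', hKi'⟩ := exists_index_commutatorPowSet (h := h') hs m hm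
  have h1 : K = K'.comap (e : gammaSubgroup h →* gammaSubgroup h') := by
    apply SetLike.coe_injective
    ext g
    rw [hK, Subgroup.coe_comap, hK']
    exact e.mem_commutatorPowSet_iff.symm
  have h2 : K.index = K'.index := by
    rw [h1]
    exact K'.index_comap_of_surjective e.surjective
  rw [hKi, hKi'] at h2
  exact Nat.pow_left_injective (n := 2) (by norm_num) h2

end Osc

theorem Fin.dvd_of_le_of_dvd_succ {n : ℕ} {r : Fin n → ℕ}
    (hr : ∀ (i : ℕ) (hi : i + 1 < n), r ⟨i, Nat.lt_of_succ_lt hi⟩ ∣ r ⟨i + 1, hi⟩)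
    (i j : Fin n) (hij : i ≤ j) : r i ∣ r j := by
  obtain ⟨i, hi⟩ := i
  obtain ⟨j, hj⟩ := j
  replace hij : i ≤ j := hij
  induction j, hij using Nat.le_induction with
  | base => exact dvd_rfl
  | succ j _ ih => exact (ih (by omega)).trans (hr j hj)

theorem mainTheorem2 (n : ℕ) (hn : 1 ≤ n) (ω : LinearMap.BilinForm ℝ (OscVec n)) (B : OscMat n)
    (h : IsOscPair ω B) (L : Subgroup (Osc h)) (hL : IsCocompactLattice L) :
    ∃! r : Fin n → ℕ,
      (∀ i, 0 < r i) ∧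
      (∀ (i : ℕ) (hi : i + 1 < n), r ⟨i, Nat.lt_of_succ_lt hi⟩ ∣ r ⟨i + 1, hi⟩) ∧
      ∃ (B' : OscMat n) (h' : IsOscPair (oscStdForm fun i => (r i : ℝ)) B')
        (Φ : Osc h ≃ₜ* Osc h') (ξ₀ : OscVec n),
        Osc.IsLatticeOf (L.map (Φ : Osc h →* Osc h')) ξ₀ := by
  refine existsUnique_of_exists_of_unique (Osc.exists_isLatticeOf hn hL) ?_
  rintro r s ⟨hr, hrd, B₁, h₁, Φ, ξ, hΦ⟩ ⟨hs, hsd, B₂, h₂, Ψ, η, hΨ⟩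
  -- `E` carries the image of `L` under `Φ` to that under `Ψ` and preserves Heisenberg groups, so it
  -- matches their intersections `Γ_r` and `Γ_s`.
  let E : Osc h₁ ≃* Osc h₂ := Φ.toMulEquiv.symm.trans Ψ.toMulEquiv
  have hE : (Osc.gammaSubgroup h₁).map (E : Osc h₁ →* Osc h₂) = Osc.gammaSubgroup h₂ := by
    rw [← hΦ.inf_heis, ← hΨ.inf_heis, Subgroup.map_inf _ _ _ E.injective, Osc.map_heis hn E,
      Subgroup.map_map]
    congr 2
    ext1 g
    change Ψ (Φ.symm (Φ g)) = Ψ g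
    rw [Φ.symm_apply_apply]
  exact Osc.eq_of_gammaSubgroup_mulEquiv hr hs (Fin.dvd_of_le_of_dvd_succ hrd)
    (Fin.dvd_of_le_of_dvd_succ hsd)
    ((E.subgroupMap (Osc.gammaSubgroup h₁)).trans (MulEquiv.subgroupCongr hE))
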